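/- **Setting.** Let $\mathcal A$ be a von Neumann algebra on a complex Hilbert space with a faithful normal tracial state $\tau$. $L^2(\mathcal A,\tau)$ is the completion of $\mathcal A$ in the norm $\|x\|_2=\tau(x^*x)^{1/2}$, and $L^1(\mathcal A,\tau)$ is realised inside $\mathcal A^*$ by $z\mapsto\tau(z\,\cdot\,)$, with the dual norm. A *white noise* $(\mathcal A,\tau,S;(\mathcal A_I)_I)$ consists of a pointwise weak* continuous one-parameter group $S=(S_t)_{t\in\mathbb R}$ of $\tau$-preserving $*$-automorphisms of $\mathcal A$ with fixed point algebra $\mathcal A_0$, and von Neumann subalgebras $\mathcal A_0\subset\mathcal A_I\subset\mathcal A$ indexed by the non-empty closed intervals $I\subset\mathbb R$ (bounded or not), such that $\mathcal A_I$ and $\mathcal A_J$ generate $\mathcal A_K$ whenever $I\cup J=K$; $\mathcal A_{\mathbb R}=\mathcal A$; $S_t(\mathcal A_I)=\mathcal A_{I+t}$; and $E_IE_J=E_0$ whenever $I^\circ\cap J^\circ=\emptyset$, where $E_I$, $E_0$ are the $\tau$-preserving conditional expectations onto $\mathcal A_I$, $\mathcal A_0$ (interiors are taken in $\mathbb R$,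 so $[s,s]^\circ=\emptyset$). $S$ and the $E_I$ are extended to $L^p(\mathcal A,\tau)$, $p=1,2$. (a) Let $\mathcal U$ be the set of weak* continuous families $u=(u_t)_{t\ge0}$ of unitaries with $u_t\in\mathcal A_{[0,t]}$ and $u_{s+t}=S_t(u_s)u_t$ for $s,t\ge0$, such that $t\mapsto E_0(u_t)$ is norm continuous in $\mathcal A_0$. (b) Let $\mathcal B$ be the set of $\|\cdot\|_2$-continuous families $b=(b_t)_{t\ge0}$ with $b_t\in L^2(\mathcal A_{[0,t]},\tau)$ and $b_{s+t}=S_t(b_s)+b_t$ for $s,t\ge0$, such that $E_0(b_t^*b_t+b_tb_t^*)\in\mathcal A_0$ for all $t\ge0$, and such that for all $t\ge 0$ the quadratic variation $[\![b,b]\!]_t=L^1\text{-}\lim\sum_j|b_{t_{j+1}}-b_{t_j}|^2$ (limit over subdivisions of $[0,t]$ as the mesh tends to $0$) exists and satisfies $[\![b,b]\!]_t+b_t^*+b_t=0$. For $u\in\mathcal U$, $b\in\mathcal B$ consider the two relations $$\text{(D)}\quad b_t=L^2\text{-}\lim_{N\to\infty}\sum_{j=0}^{N-1}S_{jt/N}(u_{t/N}-1)\quad(t\ge0),\qquad\qquad\text{(E)}\quad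 u_t=1+\int_0^t db_s\,u_s\quad(t\ge0),$$ where the Itô integral of a simple adapted process $y=\sum_j y_{s_j}\chi_{[s_j,s_{j+1})}$, $y_{s_j}\in\mathcal A_{[0,s_j]}$, is $\sum_j(b_{s_{j+1}}-b_{s_j})y_{s_j}$, extended by continuity to $L^2([0,t];L^2(\mathcal A,\tau))$-limits of such processes. A family in $L^2(\mathcal A,\tau)$ indexed by $t\ge 0$ is called *differentiable* here if it is right differentiable at $t=0$ in the weak topology of $L^2(\mathcal A,\tau)$; for $u$ (viewed in $L^2(\mathcal A,\tau)$) and $b$ this is implied by differentiability in any of the usual topologies (norm, strong, weak*, $L^2$-norm). **Corollary (Stone's theorem).** 1. Let $u\in\mathcal U$ and $b\in\mathcal B$ correspond to each other through (D) or through (E). If $u$ or $b$ is differentiable, then there is a selfadjoint $h\in\mathcal A_0$ such that $u_t=\exp(ith)$ and $b_t=ith$ for all $t\ge0$. 2. Every differentiable $u\in\mathcal U$ has a partner $b\in\mathcal B$ for which both (D) and (E) hold, and every differentiable $b\in\mathcal B$ has a partner $u\in\mathcal U$ for which both (D) and (E) hold; so part 1 applies to these pairs. -/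

import Mathlib

open Filter Topology MeasureTheory
open scoped ComplexOrder InnerProductSpace

noncomputable section

namespace QSStone

universe u

variable {H : Type u} [NormedAddCommGroup H] [InnerProductSpace ℂ H] [CompleteSpace H]

/-! ### Von Neumann algebras with a faithful normal tracial state -/

/-- The type of elements of a von Neumann algebra `M`, with the norm and *-algebra structure
inherited from the bounded operators on `H`, ordered by its positive elements. -/
def Elt (M : VonNeumannAlgebra H) : Type u := M.toStarSubalgebra

/-- A von Neumann algebra, being a commutant, is norm closed. -/
theorem isClosed_vonNeumann (M : VonNeumannAlgebra H) :
    IsClosed (M.toStarSubalgebra : Set (H →L[ℂ] H)) := by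
  rw [VonNeumannAlgebra.coe_toStarSubalgebra, ← VonNeumannAlgebra.centralizer_centralizer]
  exact Set.isClosed_centralizer _

instance (M : VonNeumannAlgebra H) : CStarAlgebra (Elt M) :=
  haveI : IsClosed (M.toStarSubalgebra : Set (H →L[ℂ] H)) := isClosed_vonNeumann M
  inferInstanceAs (CStarAlgebra M.toStarSubalgebra)

instance (M : VonNeumannAlgebra H) : PartialOrder (Elt M) := CStarAlgebra.spectralOrder (Elt M)

instance (M : VonNeumannAlgebra H) : StarOrderedRing (Elt M) :=
  CStarAlgebra.spectralOrderedRing (Elt M)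

/-- The inclusion of a von Neumann algebra into the bounded operators on `H`. -/
def Elt.op {M : VonNeumannAlgebra H} : Elt M →⋆ₐ[ℂ] (H →L[ℂ] H) := M.toStarSubalgebra.subtype

/-- A functional on `M` is normal (weak* continuous) iff it has the form
`x ↦ ∑ₙ ⟪ξₙ, x ηₙ⟫` with square summable sequences of vectors. -/
def IsNormal {M : VonNeumannAlgebra H} (φ : Elt M → ℂ) : Prop :=
  ∃ ξ η : ℕ → H, Summable (fun n => ‖ξ n‖ ^ 2) ∧ Summable (fun n => ‖η n‖ ^ 2) ∧
    ∀ x : Elt M, HasSum (fun n => ⟪ξ n, x.op (η n)⟫_ℂ) (φ x)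

/-- Weak* continuity on a set of times, tested against all normal functionals. -/
def WeakStarContinuousOn {M : VonNeumannAlgebra H} (f : ℝ → Elt M) (s : Set ℝ) : Prop :=
  ∀ φ : Elt M → ℂ, IsNormal φ → ContinuousOn (fun t => φ (f t)) s

/-- A (non-commutative) probability space: a von Neumann algebra with a faithful normal
tracial state. -/
structure ProbSpace (H : Type u) [NormedAddCommGroup H] [InnerProductSpace ℂ H]
    [CompleteSpace H] where
  alg : VonNeumannAlgebra H
  τ : Elt alg →ₚ[ℂ] ℂ
  τ_one : τ 1 = 1
  τ_mul_comm : ∀ x y, τ (x * y) = τ (y * x)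
  τ_faithful : ∀ x, τ (star x * x) = 0 → x = 0
  τ_normal : IsNormal τ

namespace ProbSpace

variable (P : ProbSpace H)

/-- The algebra `A = L^∞(A, τ)`. -/
abbrev A : Type u := Elt P.alg

/-! ### The space `L²(A, τ)` -/

/-- `L²(A, τ)`: the completion of `A` for the inner product `⟪x, y⟫ = τ (x* y)`. -/
abbrev L2 : Type u := P.τ.GNS

/-- The canonical embedding `A → L²(A, τ)`. -/
def ι : P.A →ₗ[ℂ] P.L2 :=
  (UniformSpace.Completion.toComplL (𝕜 := ℂ) (E := P.τ.PreGNS)).toLinearMap ∘ₗ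
    P.τ.toPreGNS.toLinearMap

theorem inner_ι (x y : P.A) : ⟪P.ι x, P.ι y⟫_ℂ = P.τ (star x * y) :=
  UniformSpace.Completion.inner_coe _ _

/-- Left multiplication by an element of `A` on `L²(A, τ)`. -/
def leftMul (a : P.A) : P.L2 →L[ℂ] P.L2 := P.τ.gnsStarAlgHom a

theorem norm_preGNS_sq (x : P.τ.PreGNS) :
    ‖x‖ ^ 2 = (P.τ (star (P.τ.ofPreGNS x) * P.τ.ofPreGNS x)).re := by
  have := congrArg Complex.re (P.τ.preGNS_norm_sq x)
  rwa [← Complex.ofReal_pow, Complex.ofReal_re] at this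

/-- The adjoint `x ↦ x*`, as a conjugate linear isometry for the `L²`-norm. -/
def preAdj : P.τ.PreGNS →SL[starRingEnd ℂ] P.τ.PreGNS :=
  LinearMap.mkContinuous
    { toFun := fun x => P.τ.toPreGNS (star (P.τ.ofPreGNS x))
      map_add' := fun x y => by simp
      map_smul' := fun c x => by simp [star_smul] } 1 fun x => by
    rw [one_mul, ← sq_le_sq₀ (norm_nonneg _) (norm_nonneg _), norm_preGNS_sq, norm_preGNS_sq]
    simp [P.τ_mul_comm (P.τ.ofPreGNS x)]

/-- The adjoint `ξ ↦ ξ*` on `L²(A, τ)`. -/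
def adj : P.L2 →SL[starRingEnd ℂ] P.L2 := P.preAdj.completion

theorem adj_ι (x : P.A) : P.adj (P.ι x) = P.ι (star x) :=
  P.preAdj.completion_apply_coe _

/-- Right multiplication by an element of `A` on `L²(A, τ)`: `ξ a = (a* ξ*)*`. -/
def rightMul (a : P.A) : P.L2 →L[ℂ] P.L2 :=
  (P.adj.comp (P.leftMul (star a))).comp P.adj

theorem leftMul_ι (a x : P.A) : P.leftMul a (P.ι x) = P.ι (a * x) :=
  P.τ.gnsNonUnitalStarAlgHom_apply_coe

theorem rightMul_ι (a x : P.A) : P.rightMul a (P.ι x) = P.ι (x * a) := by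
  simp [rightMul, adj_ι, leftMul_ι]

/-- The extension to `L²(A, τ)` of a trace preserving automorphism of `A`. -/
def autL2 (T : P.A ≃⋆ₐ[ℂ] P.A) (hT : ∀ x, P.τ (T x) = P.τ x) : P.L2 →L[ℂ] P.L2 :=
  ContinuousLinearMap.completion <|
    LinearMap.mkContinuous
      { toFun := fun x : P.τ.PreGNS => P.τ.toPreGNS (T (P.τ.ofPreGNS x))
        map_add' := fun x y => by simp
        map_smul' := fun c x => by simp } 1 fun x => by
      rw [one_mul, ← sq_le_sq₀ (norm_nonneg _) (norm_nonneg _), norm_preGNS_sq, norm_preGNS_sq]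
      simp [← map_star, ← map_mul, hT]

theorem autL2_ι (T : P.A ≃⋆ₐ[ℂ] P.A) (hT : ∀ x, P.τ (T x) = P.τ x) (x : P.A) :
    P.autL2 T hT (P.ι x) = P.ι (T x) :=
  ContinuousLinearMap.completion_apply_coe _ _

/-- `L²(B, τ)` as a closed subspace of `L²(A, τ)`, for a von Neumann subalgebra `B`:
the closure of `A ∩ B`. -/
def L2sub (B : VonNeumannAlgebra H) : Submodule ℂ P.L2 :=
  ((B.toStarSubalgebra.toSubalgebra.toSubmodule.comap
    (Elt.op (M := P.alg)).toLinearMap).map P.ι).topologicalClosure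

instance (B : VonNeumannAlgebra H) : CompleteSpace (P.L2sub B) :=
  (Submodule.isClosed_topologicalClosure _).completeSpace_coe

/-- The conditional expectation onto `B`, on `L²(A, τ)`: the orthogonal projection onto
`L²(B, τ)`. Its restriction to `A` is the trace preserving conditional expectation. -/
def condExp (B : VonNeumannAlgebra H) : P.L2 →L[ℂ] P.L2 := (P.L2sub B).starProjection

/-! ### The space `L¹(A, τ)` -/

/-- `L¹(A, τ)` lies isometrically in the dual of `A`, as the predual of `A`: an element `z` is
identified with the functional `a ↦ τ (z a)`. -/
abbrev L1 : Type u := StrongDual ℂ P.A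

theorem norm_leftMul_le (a : P.A) : ‖P.leftMul a‖ ≤ ‖a‖ :=
  NonUnitalStarAlgHom.norm_apply_le P.τ.gnsStarAlgHom a

theorem norm_adj_le (ξ : P.L2) : ‖P.adj ξ‖ ≤ ‖ξ‖ := by
  induction ξ using UniformSpace.Completion.induction_on with
  | hp => exact isClosed_le (by fun_prop) (by fun_prop)
  | ih x =>
    have h1 : P.adj (x : P.L2) = ((P.preAdj x : P.τ.PreGNS) : P.L2) :=
      P.preAdj.completion_apply_coe x
    rw [h1, UniformSpace.Completion.norm_coe, UniformSpace.Completion.norm_coe]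
    simpa using P.preAdj.le_of_opNorm_le (LinearMap.mkContinuous_norm_le _ zero_le_one _) x

theorem norm_rightMul_apply_le (a : P.A) (η : P.L2) : ‖P.rightMul a η‖ ≤ ‖a‖ * ‖η‖ := by
  have h := (P.leftMul (star a)).le_of_opNorm_le (P.norm_leftMul_le (star a)) (P.adj η)
  rw [norm_star] at h
  exact (P.norm_adj_le _).trans (h.trans (by gcongr; exact P.norm_adj_le η))

/-- The product `ξ* η ∈ L¹(A, τ)` of `ξ, η ∈ L²(A, τ)`: `τ (ξ* η a) = ⟪ξ, η a⟫`. -/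
def starMul (ξ η : P.L2) : P.L1 :=
  LinearMap.mkContinuous
    { toFun := fun a => ⟪ξ, P.rightMul a η⟫_ℂ
      map_add' := fun a b => by simp [rightMul, leftMul, inner_add_right]
      map_smul' := fun c a => by simp [rightMul, leftMul, inner_smul_right] } (‖ξ‖ * ‖η‖)
    fun a => by
      refine (norm_inner_le_norm (𝕜 := ℂ) ξ (P.rightMul a η)).trans ?_
      rw [mul_assoc, mul_comm ‖η‖]
      gcongr
      exact P.norm_rightMul_apply_le a η

/-- The embedding `L²(A, τ) → L¹(A, τ)`, `η ↦ 1* η`. -/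
def toL1 (η : P.L2) : P.L1 := P.starMul (P.ι 1) η

theorem starMul_ι (x y a : P.A) : P.starMul (P.ι x) (P.ι y) a = P.τ (star x * y * a) := by
  simp [starMul, rightMul_ι, inner_ι, mul_assoc]

/-- For `z ∈ L¹(A, τ)`: the conditional expectation of `z` onto `B` is the bounded element
`k ∈ B = L^∞(B, τ)`. -/
def HasCondExpL1 (B : VonNeumannAlgebra H) (z : P.L1) (k : P.A) : Prop :=
  k.op ∈ B ∧ ∀ y : P.A, y.op ∈ B → z y = P.τ (k * y)

end ProbSpace

/-! ### White noises -/

/-- The non-empty closed intervals of the real line, bounded or not. -/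
def IsInterval (I : Set ℝ) : Prop := I.Nonempty ∧ IsClosed I ∧ I.OrdConnected

/-- An operator-valued white noise. Here `base` is the algebra `A₀` and `filt I` is `A_I`, which
only matters for intervals `I`. -/
structure WhiteNoise (H : Type u) [NormedAddCommGroup H] [InnerProductSpace ℂ H]
    [CompleteSpace H] extends ProbSpace H where
  /-- the shift: a weak* continuous group of trace preserving automorphisms -/
  S : ℝ → (Elt alg ≃⋆ₐ[ℂ] Elt alg)
  S_add : ∀ s t x, S (s + t) x = S s (S t x)
  S_trace : ∀ t x, τ (S t x) = τ x
  S_continuous : ∀ x, WeakStarContinuousOn (fun t => S t x) Set.univ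
  /-- the fixed point algebra of the shift -/
  base : VonNeumannAlgebra H
  base_le : base ≤ alg
  mem_base : ∀ x : Elt alg, x.op ∈ base ↔ ∀ t, S t x = x
  /-- the filtration -/
  filt : Set ℝ → VonNeumannAlgebra H
  filt_le : ∀ I, IsInterval I → filt I ≤ alg
  base_le_filt : ∀ I, IsInterval I → base ≤ filt I
  filt_generates : ∀ I J K, IsInterval I → IsInterval J → IsInterval K → I ∪ J = K →
    (filt K : Set (H →L[ℂ] H)) =
      Set.centralizer (Set.centralizer ((filt I : Set (H →L[ℂ] H)) ∪ filt J))
  filt_minimal : filt Set.univ = alg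
  filt_shift : ∀ t I, IsInterval I → ∀ x : Elt alg,
    (S t x).op ∈ filt ((fun r => r + t) '' I) ↔ x.op ∈ filt I
  /-- independence over `A₀` of the past and the future -/
  independent : ∀ I J, IsInterval I → IsInterval J → interior I ∩ interior J = ∅ →
    toProbSpace.condExp (filt I) ∘L toProbSpace.condExp (filt J) = toProbSpace.condExp base

namespace WhiteNoise

variable (W : WhiteNoise H)

/-- The shift on `L²(A, τ)`. -/
def S2 (t : ℝ) : W.L2 →L[ℂ] W.L2 := W.autL2 (W.S t) (W.S_trace t)

/-- Unitary cocycles for the shift; only the values at times `t ≥ 0` matter. -/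
structure IsUnitaryCocycle (u : ℝ → W.A) : Prop where
  unitary : ∀ t, 0 ≤ t → u t ∈ unitary W.A
  continuous : WeakStarContinuousOn u (Set.Ici 0)
  adapted : ∀ t, 0 ≤ t → (u t).op ∈ W.filt (Set.Icc 0 t)
  cocycle : ∀ s t, 0 ≤ s → 0 ≤ t → u (s + t) = W.S t (u s) * u t

/-- Additive `L²`-cocycles for the shift; only the values at times `t ≥ 0` matter. -/
structure IsAdditiveCocycle (b : ℝ → W.L2) : Prop where
  continuous : ContinuousOn b (Set.Ici 0)
  adapted : ∀ t, 0 ≤ t → b t ∈ W.L2sub (W.filt (Set.Icc 0 t))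
  cocycle : ∀ s t, 0 ≤ s → 0 ≤ t → b (s + t) = W.S2 t (b s) + b t

/-- `0 = p 0 < p 1 < ⋯ < p n = t` is a subdivision of `[0, t]`. -/
structure IsSubdivision (t : ℝ) (n : ℕ) (p : ℕ → ℝ) : Prop where
  zero : p 0 = 0
  last : p n = t
  lt : ∀ j < n, p j < p (j + 1)

/-- `q` is the quadratic variation `[[b, b]]_t`: the `L¹`-limit of the sums of
`|b_{p (j + 1)} - b_{p j}|²` over the subdivisions `p` of `[0, t]`, as the mesh tends to `0`. -/
def IsQuadVar (b : ℝ → W.L2) (t : ℝ) (q : W.L1) : Prop :=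
  ∀ ε > 0, ∃ δ > 0, ∀ (n : ℕ) (p : ℕ → ℝ), IsSubdivision t n p →
    (∀ j < n, p (j + 1) - p j < δ) →
    ‖(∑ j ∈ Finset.range n,
      W.starMul (b (p (j + 1)) - b (p j)) (b (p (j + 1)) - b (p j))) - q‖ < ε

/-- Unitary adapted cocycles `u` such that the semigroup `E₀(u)` is norm continuous
in `A₀`. -/
structure IsUnitaryData (u : ℝ → W.A) : Prop extends W.IsUnitaryCocycle u where
  norm_continuous : ∃ e : ℝ → W.A,
    (∀ t, 0 ≤ t → (e t).op ∈ W.base ∧ W.ι (e t) = W.condExp W.base (W.ι (u t))) ∧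
    ContinuousOn e (Set.Ici 0)

/-- Additive adapted `L²`-cocycles `b` with bounded symmetric covariance
`E₀(b* b + b b*)` which satisfy the structure equation `[[b, b]] + b* + b = 0`. -/
structure IsAdditiveData (b : ℝ → W.L2) : Prop extends W.IsAdditiveCocycle b where
  covariance : ∀ t, 0 ≤ t → ∃ k : W.A, W.HasCondExpL1 W.base
    (W.starMul (b t) (b t) + W.starMul (W.adj (b t)) (W.adj (b t))) k
  structure_equation : ∀ t, 0 ≤ t → ∃ q : W.L1, W.IsQuadVar b t q ∧
    q + W.toL1 (W.adj (b t)) + W.toL1 (b t) = 0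

/-- `b` is the stochastic derivative of `u`:
`b t = lim_N ∑_{j < N} S_{j t / N} (u_{t / N} - 1)` in `L²(A, τ)`. -/
def IsStochasticDerivative (u : ℝ → W.A) (b : ℝ → W.L2) : Prop :=
  ∀ t, 0 ≤ t → Tendsto
    (fun N : ℕ => ∑ j ∈ Finset.range N, W.S2 (j * t / N) (W.ι (u (t / N) - 1)))
    atTop (𝓝 (b t))

/-- A simple adapted process on `[0, t]` with values in `A`, which is equal to `val j` on
`[pt j, pt (j + 1))`. -/
structure StepIntegrand (t : ℝ) where
  n : ℕ
  pt : ℕ → ℝ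
  subdivision : IsSubdivision t n pt
  val : ℕ → W.A
  adapted : ∀ j < n, (val j).op ∈ W.filt (Set.Icc 0 (pt j))

variable {W} in
/-- The process as a function on `[0, t]`. -/
def StepIntegrand.toFun {t : ℝ} (y : W.StepIntegrand t) (s : ℝ) : W.L2 :=
  ∑ j ∈ Finset.range y.n,
    (Set.Ico (y.pt j) (y.pt (j + 1))).indicator (fun _ => W.ι (y.val j)) s

variable {W} in
/-- The (left) Itô integral of a simple process: `∑_j (b_{pt (j + 1)} - b_{pt j}) y_{pt j}`. -/
def StepIntegrand.integral {t : ℝ} (y : W.StepIntegrand t) (b : ℝ → W.L2) : W.L2 :=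
  ∑ j ∈ Finset.range y.n, W.rightMul (y.val j) (b (y.pt (j + 1)) - b (y.pt j))

/-- `z = ∫₀ᵗ db_s y_s`: the Itô integral is extended by continuity, from the simple processes to
the closure of the simple processes in the square integrable `L²(A, τ)`-valued functions. -/
def IsItoIntegral (b y : ℝ → W.L2) (t : ℝ) (z : W.L2) : Prop :=
  ∃ x : ℕ → W.StepIntegrand t,
    Tendsto (fun m => ∫⁻ s in Set.Ico 0 t, ‖(x m).toFun s - y s‖ₑ ^ 2) atTop (𝓝 0) ∧
    Tendsto (fun m => (x m).integral b) atTop (𝓝 z)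

/-- `u` solves the stochastic differential equation `u_t = 1 + ∫₀ᵗ db_s u_s`. -/
def SolvesSDE (b : ℝ → W.L2) (u : ℝ → W.A) : Prop :=
  ∀ t, 0 ≤ t → W.IsItoIntegral b (fun s => W.ι (u s)) t (W.ι (u t - 1))

/-- Differentiability from the right at time `0`, in the weak topology of `L²(A, τ)`. It follows
from differentiability in any of the usual topologies of `A` and `L²(A, τ)`. -/
def WeaklyDifferentiableAtZero (f : ℝ → W.L2) : Prop :=
  ∀ ξ : W.L2, DifferentiableWithinAt ℝ (fun t => ⟪ξ, f t⟫_ℂ) (Set.Ici 0) 0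

end WhiteNoise

end QSStone

end

/-!
Write `E₀` for the conditional expectation onto `A₀`.

An additive cocycle splits as `b_t = t k + m_t` with drift `k = E₀ b_1`. By independence the
increments of `m` are orthogonal, so `‖m_t‖² = t ‖m_1‖²`
(`IsAdditiveCocycle.norm_sq_martingale`). Weak differentiability bounds `‖b_t‖ / t` along
`t = 1 / n`, which forces `m = 0`. The trace of the structure equation reads
`‖m_1‖² = -2 Re ⟪1, k⟫` (`IsAdditiveData.norm_sq_sub_drift`), and once `m = 0` the quadratic
variation vanishes, so that the structure equation says `k* = -k`.

For a unitary cocycle, `E₀(u_t)` is a norm continuous semigroup in `A₀`, hence `exp (t G)` with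
`G ∈ A₀` (`IsUnitaryData.exists_generator`). If `u` is weakly differentiable, then
`‖u_t - 1‖₂ = O(t)` along `t = 1 / n`, and `E₀ (u_t + u_t* - 2) = -E₀ |u_t - 1|²` gives
`G* = -G` (`IsGenerator.star_eq_neg`). Whenever `G* = -G`, the compression `exp (t G)` of `u_t` is
unitary, so it has the same `L²`-norm as `u_t` and is equal to it (`IsGenerator.eq_exp`).

Either of the two relations between `u` and `b` yields `k = G`, on applying `E₀`
(`IsGenerator.drift_eq_of_derivative`, `IsGenerator.drift_eq_of_solvesSDE`). Hence
differentiability of one of the two gives `m = 0`, `k = G = -G*`, `u_t = exp (t G)` and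
`b_t = t G`.

Conversely `exp (t G)` and `t G` are partners for each skew adjoint `G ∈ A₀`; the Itô integral is a
limit of Riemann sums that are geometric sums. What remains is that the drift of a differentiable
`b` is bounded. The covariance condition bounds `y ↦ k y` in the `L²`-norm. Resolvents of skew
adjoint elements of `A₀` approximating `k` are contractions and `L²`-Cauchy; norm bounded sets are
`L²`-complete, so they converge to some `w ∈ A₀` inverse to `1 + k`, and the bound on `k` makes `w`
invertible in `A₀` (`ProbSpace.exists_ι_eq_of_bounded`).
-/

namespace QSStone

universe u

variable {H : Type u} [NormedAddCommGroup H] [InnerProductSpace ℂ H] [CompleteSpace H]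

/-! ### Elements of `A` and of `L²(A, τ)` -/

namespace ProbSpace

variable (P : ProbSpace H)

/-- For a von Neumann algebra `B`, the elements of `A` which lie in `B`. -/
noncomputable def sub (B : VonNeumannAlgebra H) : StarSubalgebra ℂ P.A :=
  B.toStarSubalgebra.comap (Elt.op (M := P.alg))

variable {P}

instance isClosed_sub (B : VonNeumannAlgebra H) : IsClosed (P.sub B : Set P.A) :=
  (isClosed_vonNeumann B).preimage (continuous_subtype_val (p := (· ∈ P.alg.toStarSubalgebra)))

theorem ι_mem_L2sub {B : VonNeumannAlgebra H} {x : P.A} (hx : x ∈ P.sub B) :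
    P.ι x ∈ P.L2sub B :=
  Submodule.le_topologicalClosure _ ⟨x, hx, rfl⟩

theorem L2sub_induction {B : VonNeumannAlgebra H} {p : P.L2 → Prop} (hp : IsClosed {ξ | p ξ})
    (h : ∀ x ∈ P.sub B, p (P.ι x)) {ξ : P.L2} (hξ : ξ ∈ P.L2sub B) : p ξ := by
  refine closure_minimal ?_ hp hξ
  rintro _ ⟨x, hx, rfl⟩
  exact h x hx

theorem L2_induction {p : P.L2 → Prop} (hp : IsClosed {ξ | p ξ}) (h : ∀ x, p (P.ι x))
    (ξ : P.L2) : p ξ := by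
  induction ξ using UniformSpace.Completion.induction_on with
  | hp => exact hp
  | ih x => exact h (P.τ.ofPreGNS x)

theorem norm_ι_sq (x : P.A) : ((‖P.ι x‖ ^ 2 : ℝ) : ℂ) = P.τ (star x * x) := by
  rw [← inner_ι, inner_self_eq_norm_sq_to_K]; simp

theorem norm_ι_sq_re (x : P.A) : ‖P.ι x‖ ^ 2 = (P.τ (star x * x)).re := by
  rw [← norm_ι_sq, Complex.ofReal_re]

theorem ι_injective : Function.Injective P.ι := by
  rw [injective_iff_map_eq_zero]
  intro x hx
  apply P.τ_faithful
  rw [← norm_ι_sq, hx]; simp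

theorem τ_star (x : P.A) : P.τ (star x) = star (P.τ x) := map_star P.τ x

theorem τ_eq_inner (x : P.A) : P.τ x = ⟪P.ι 1, P.ι x⟫_ℂ := by simp [inner_ι]

theorem norm_ι_one : ‖P.ι 1‖ = 1 := by
  have := P.norm_ι_sq_re 1
  rw [star_one, one_mul, P.τ_one, Complex.one_re] at this
  nlinarith [norm_nonneg (P.ι 1)]

theorem norm_ι_le (x : P.A) : ‖P.ι x‖ ≤ ‖x‖ := by
  have h := (P.leftMul x).le_of_opNorm_le (P.norm_leftMul_le x) (P.ι 1)
  rwa [leftMul_ι, mul_one, norm_ι_one, mul_one] at h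

theorem continuous_ι : Continuous P.ι :=
  AddMonoidHomClass.continuous_of_bound P.ι 1 fun x => by simpa using P.norm_ι_le x

theorem norm_ι_unitary {u : P.A} (hu : u ∈ unitary P.A) : ‖P.ι u‖ = 1 := by
  have := P.norm_ι_sq_re u
  rw [Unitary.star_mul_self_of_mem hu, P.τ_one, Complex.one_re] at this
  nlinarith [norm_nonneg (P.ι u)]

theorem norm_leftMul_apply_le (a : P.A) (η : P.L2) : ‖P.leftMul a η‖ ≤ ‖a‖ * ‖η‖ :=
  (P.leftMul a).le_of_opNorm_le (P.norm_leftMul_le a) η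

theorem inner_adj (ξ η : P.L2) : ⟪P.adj ξ, P.adj η⟫_ℂ = ⟪η, ξ⟫_ℂ := by
  induction ξ using L2_induction with
  | hp => exact isClosed_eq (by fun_prop) (by fun_prop)
  | h x =>
    induction η using L2_induction with
    | hp => exact isClosed_eq (by fun_prop) (by fun_prop)
    | h y => simp [adj_ι, inner_ι, P.τ_mul_comm x]

theorem adj_adj (ξ : P.L2) : P.adj (P.adj ξ) = ξ := by
  induction ξ using L2_induction with
  | hp => exact isClosed_eq (by fun_prop) (by fun_prop)
  | h x => simp [adj_ι]

theorem norm_adj (ξ : P.L2) : ‖P.adj ξ‖ = ‖ξ‖ :=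
  le_antisymm (P.norm_adj_le ξ) (by simpa [adj_adj] using P.norm_adj_le (P.adj ξ))

theorem inner_leftMul (a : P.A) (ξ η : P.L2) :
    ⟪P.leftMul a ξ, η⟫_ℂ = ⟪ξ, P.leftMul (star a) η⟫_ℂ := by
  induction ξ using L2_induction with
  | hp => exact isClosed_eq (by fun_prop) (by fun_prop)
  | h x =>
    induction η using L2_induction with
    | hp => exact isClosed_eq (by fun_prop) (by fun_prop)
    | h y => simp [leftMul_ι, inner_ι, mul_assoc]

/-- Traciality: right multiplication by `a*` is the adjoint of right multiplication by `a`. -/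
theorem inner_rightMul (a : P.A) (ξ η : P.L2) :
    ⟪P.rightMul a ξ, η⟫_ℂ = ⟪ξ, P.rightMul (star a) η⟫_ℂ := by
  induction ξ using L2_induction with
  | hp => exact isClosed_eq (by fun_prop) (by fun_prop)
  | h x =>
    induction η using L2_induction with
    | hp => exact isClosed_eq (by fun_prop) (by fun_prop)
    | h y =>
      simp only [rightMul_ι, inner_ι, star_mul]
      rw [mul_assoc, P.τ_mul_comm, mul_assoc]

theorem rightMul_rightMul (a b : P.A) (ξ : P.L2) :
    P.rightMul a (P.rightMul b ξ) = P.rightMul (b * a) ξ := by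
  induction ξ using L2_induction with
  | hp => exact isClosed_eq (by fun_prop) (by fun_prop)
  | h x => simp [rightMul_ι, mul_assoc]

theorem leftMul_leftMul (a b : P.A) (ξ : P.L2) :
    P.leftMul a (P.leftMul b ξ) = P.leftMul (a * b) ξ := by
  induction ξ using L2_induction with
  | hp => exact isClosed_eq (by fun_prop) (by fun_prop)
  | h x => simp [leftMul_ι, mul_assoc]

theorem eq_of_inner_ι_eq {ξ η : P.L2} (h : ∀ a, ⟪P.ι a, ξ⟫_ℂ = ⟪P.ι a, η⟫_ℂ) : ξ = η := by
  refine ext_inner_left ℂ fun ζ => ?_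
  induction ζ using L2_induction with
  | hp => exact isClosed_eq (by fun_prop) (by fun_prop)
  | h a => exact h a

theorem eq_of_mem_L2sub_of_inner_eq {B : VonNeumannAlgebra H} {ξ η : P.L2} (hξ : ξ ∈ P.L2sub B)
    (hη : η ∈ P.L2sub B) (h : ∀ a ∈ P.sub B, ⟪P.ι a, ξ⟫_ℂ = ⟪P.ι a, η⟫_ℂ) : ξ = η := by
  rw [← sub_eq_zero, ← inner_self_eq_zero (𝕜 := ℂ)]
  have key : ∀ ζ ∈ P.L2sub B, ⟪ζ, ξ - η⟫_ℂ = 0 := by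
    intro ζ hζ
    refine L2sub_induction (p := fun ζ => ⟪ζ, ξ - η⟫_ℂ = 0)
      (isClosed_eq (by fun_prop) (by fun_prop)) (fun a ha => ?_) hζ
    rw [inner_sub_right, h a ha, sub_self]
  exact key _ (sub_mem hξ hη)

theorem condExp_mem (B : VonNeumannAlgebra H) (ξ : P.L2) : P.condExp B ξ ∈ P.L2sub B :=
  Submodule.starProjection_apply_mem _ _

theorem condExp_of_mem {B : VonNeumannAlgebra H} {ξ : P.L2} (hξ : ξ ∈ P.L2sub B) :
    P.condExp B ξ = ξ :=
  Submodule.starProjection_eq_self_iff.2 hξ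

theorem inner_condExp (B : VonNeumannAlgebra H) (ξ η : P.L2) :
    ⟪P.condExp B ξ, η⟫_ℂ = ⟪ξ, P.condExp B η⟫_ℂ :=
  Submodule.inner_starProjection_left_eq_right _ _ _

theorem inner_condExp_of_mem {B : VonNeumannAlgebra H} {ξ : P.L2} (hξ : ξ ∈ P.L2sub B)
    (η : P.L2) : ⟪ξ, P.condExp B η⟫_ℂ = ⟪ξ, η⟫_ℂ := by
  rw [← inner_condExp, condExp_of_mem hξ]

theorem inner_autL2 (T : P.A ≃⋆ₐ[ℂ] P.A) (hT : ∀ x, P.τ (T x) = P.τ x) (ξ η : P.L2) :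
    ⟪P.autL2 T hT ξ, P.autL2 T hT η⟫_ℂ = ⟪ξ, η⟫_ℂ := by
  induction ξ using L2_induction with
  | hp => exact isClosed_eq (by fun_prop) (by fun_prop)
  | h x =>
    induction η using L2_induction with
    | hp => exact isClosed_eq (by fun_prop) (by fun_prop)
    | h y => rw [autL2_ι, autL2_ι, inner_ι, inner_ι, ← map_star, ← map_mul, hT]

theorem norm_autL2 (T : P.A ≃⋆ₐ[ℂ] P.A) (hT : ∀ x, P.τ (T x) = P.τ x) (ξ : P.L2) :
    ‖P.autL2 T hT ξ‖ = ‖ξ‖ := by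
  rw [← sq_eq_sq₀ (norm_nonneg _) (norm_nonneg _), ← inner_self_eq_norm_sq (𝕜 := ℂ),
    ← inner_self_eq_norm_sq (𝕜 := ℂ), inner_autL2]

theorem starMul_apply (ξ η : P.L2) (a : P.A) : P.starMul ξ η a = ⟪ξ, P.rightMul a η⟫_ℂ := rfl

theorem rightMul_one (ξ : P.L2) : P.rightMul 1 ξ = ξ := by
  induction ξ using L2_induction with
  | hp => exact isClosed_eq (by fun_prop) (by fun_prop)
  | h x => simp [rightMul_ι]

theorem norm_starMul_le (ξ η : P.L2) : ‖P.starMul ξ η‖ ≤ ‖ξ‖ * ‖η‖ :=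
  LinearMap.mkContinuous_norm_le _ (by positivity) _

theorem toL1_apply (η : P.L2) (a : P.A) : P.toL1 η a = ⟪P.ι (star a), η⟫_ℂ := by
  rw [toL1, starMul_apply, ← star_star a, ← inner_rightMul, rightMul_ι]; simp

theorem toL1_injective {ξ η : P.L2} (h : P.toL1 ξ = P.toL1 η) : ξ = η :=
  eq_of_inner_ι_eq fun a => by simpa [toL1_apply] using DFunLike.congr_fun h (star a)

end ProbSpace

/-! ### Normal functionals -/

/-- A normal functional composed with a left multiplication is normal. -/
theorem IsNormal.comp_mul_left {M : VonNeumannAlgebra H} {φ : Elt M → ℂ} (hφ : IsNormal φ)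
    (a : Elt M) : IsNormal fun x => φ (a * x) := by
  obtain ⟨ξ, η, hξ, hη, h⟩ := hφ
  refine ⟨fun n => ContinuousLinearMap.adjoint a.op (ξ n), η, ?_, hη, fun x => ?_⟩
  · refine Summable.of_nonneg_of_le (fun n => by positivity) (fun n => ?_)
      (hξ.mul_left (‖ContinuousLinearMap.adjoint a.op‖ ^ 2))
    rw [← mul_pow]
    gcongr
    exact ContinuousLinearMap.le_opNorm _ _
  · simpa [ContinuousLinearMap.adjoint_inner_left] using h (a * x)

/-- A normal functional is weakly continuous along norm bounded families of operators. -/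
theorem IsNormal.tendsto {M : VonNeumannAlgebra H} {φ : Elt M → ℂ} (hφ : IsNormal φ)
    {α : Type*} {l : Filter α} {x : α → Elt M} {y : Elt M} {C : ℝ} (hx : ∀ i, ‖x i‖ ≤ C)
    (hxy : ∀ ξ η : H, Tendsto (fun i => ⟪ξ, (x i).op η⟫_ℂ) l (𝓝 ⟪ξ, y.op η⟫_ℂ)) :
    Tendsto (fun i => φ (x i)) l (𝓝 (φ y)) := by
  obtain ⟨ξ, η, hξ, hη, h⟩ := hφ
  have e : ∀ x, φ x = ∑' n, ⟪ξ n, x.op (η n)⟫_ℂ := fun x => (h x).tsum_eq.symm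
  simp only [e]
  refine tendsto_tsum_of_dominated_convergence (bound := fun n => C * (‖ξ n‖ ^ 2 + ‖η n‖ ^ 2))
    ((hξ.add hη).mul_left C) (fun n => hxy _ _) (Eventually.of_forall fun i n => ?_)
  have h1 : ‖(x i).op (η n)‖ ≤ C * ‖η n‖ := ((x i).op).le_of_opNorm_le (hx i) _
  have hC : 0 ≤ C := (norm_nonneg _).trans (hx i)
  calc ‖⟪ξ n, (x i).op (η n)⟫_ℂ‖ ≤ ‖ξ n‖ * ‖(x i).op (η n)‖ := norm_inner_le_norm _ _
    _ ≤ ‖ξ n‖ * (C * ‖η n‖) := by gcongr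
    _ = C * (‖ξ n‖ * ‖η n‖) := by ring
    _ ≤ _ := by gcongr; nlinarith [sq_nonneg (‖ξ n‖ - ‖η n‖), sq_nonneg ‖ξ n‖, sq_nonneg ‖η n‖]

/-- A bounded norm continuous family is weak* continuous. -/
theorem weakStarContinuousOn_of_bounded {M : VonNeumannAlgebra H} {f : ℝ → Elt M} {s : Set ℝ}
    (hf : ContinuousOn f s) (hb : ∃ C, ∀ t, ‖f t‖ ≤ C) : WeakStarContinuousOn f s := by
  obtain ⟨C, hC⟩ := hb
  intro φ hφ t ht
  refine hφ.tendsto hC fun ξ η => ?_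
  have h1 : Continuous (Elt.op (M := M)) := continuous_subtype_val
  exact Tendsto.inner tendsto_const_nhds
    (((ContinuousLinearMap.apply ℂ H η).continuous.tendsto _).comp
      ((h1.tendsto _).comp (hf t ht)))

end QSStone

/-! ### Additive functions on the half line -/

/-- A continuous additive function on the half line is linear. -/
theorem eq_smul_of_additive {E : Type*} [NormedAddCommGroup E] [NormedSpace ℝ E] {f : ℝ → E}
    (hf : ContinuousOn f (Set.Ici 0)) (hadd : ∀ s t, 0 ≤ s → 0 ≤ t → f (s + t) = f s + f t)
    {t : ℝ} (ht : 0 ≤ t) : f t = t • f 1 := by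
  have h0 : f 0 = 0 := by simpa using hadd 0 0 le_rfl le_rfl
  let g : ℝ →+ E :=
    { toFun := fun x => f (max x 0) - f (max (-x) 0)
      map_zero' := by simp
      map_add' := fun x y => by
        have p : ∀ x : ℝ, 0 ≤ max x 0 := fun x => le_max_right _ _
        -- compare `(x + y)⁺ + x⁻ + y⁻` with `(x + y)⁻ + x⁺ + y⁺`
        have e : max (x + y) 0 + (max (-x) 0 + max (-y) 0)
            = max (-(x + y)) 0 + (max x 0 + max y 0) := by
          have q : ∀ x : ℝ, max x 0 = max (-x) 0 + x := fun x => by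
            rcases le_total x 0 with h | h
            · rw [max_eq_right h, max_eq_left (by linarith)]; ring
            · rw [max_eq_left h, max_eq_right (by linarith)]; ring
          rw [q (x + y), q x, q y]; ring
        have e' := congrArg f e
        rw [hadd _ _ (p _) (add_nonneg (p _) (p _)), hadd _ _ (p _) (p _),
          hadd _ _ (p _) (add_nonneg (p _) (p _)), hadd _ _ (p _) (p _)] at e'
        rw [sub_add_sub_comm, sub_eq_sub_iff_add_eq_add, e', add_comm] }
  have hg : Continuous g := by
    refine Continuous.sub ?_ ?_ <;>
    exact hf.comp_continuous (by fun_prop) fun x => Set.mem_Ici.2 (le_max_right _ _)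
  have e : ∀ x, 0 ≤ x → g x = f x := fun x hx => by
    change f (max x 0) - f (max (-x) 0) = f x
    rw [max_eq_left hx, max_eq_right (by linarith), h0, sub_zero]
  have := map_real_smul g hg t 1
  rwa [smul_eq_mul, mul_one, e t ht, e 1 zero_le_one] at this

namespace QSStone

universe u

variable {H : Type u} [NormedAddCommGroup H] [InnerProductSpace ℂ H] [CompleteSpace H]

open ProbSpace

/-! ### The shift and the filtration -/

theorem isInterval_Icc {s t : ℝ} (h : s ≤ t) : IsInterval (Set.Icc s t) :=
  ⟨Set.nonempty_Icc.2 h, isClosed_Icc, Set.ordConnected_Icc⟩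

namespace WhiteNoise

variable {W : WhiteNoise H}

/-- `S_0` is an injective idempotent. -/
theorem S_zero (x : W.A) : W.S 0 x = x :=
  by
  have h := W.S_add 0 0 x
  rw [add_zero] at h
  exact (EquivLike.injective (W.S 0) h).symm

theorem S_of_mem_base {x : W.A} (hx : x ∈ W.sub W.base) (t : ℝ) : W.S t x = x :=
  (W.mem_base x).1 hx t

theorem S2_ι (t : ℝ) (x : W.A) : W.S2 t (W.ι x) = W.ι (W.S t x) := W.autL2_ι _ _ _

theorem S2_zero (ξ : W.L2) : W.S2 0 ξ = ξ := by
  induction ξ using L2_induction with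
  | hp => exact isClosed_eq (by fun_prop) (by fun_prop)
  | h x => rw [S2_ι, S_zero]

theorem inner_S2 (t : ℝ) (ξ η : W.L2) : ⟪W.S2 t ξ, W.S2 t η⟫_ℂ = ⟪ξ, η⟫_ℂ := inner_autL2 _ _ _ _

theorem norm_S2 (t : ℝ) (ξ : W.L2) : ‖W.S2 t ξ‖ = ‖ξ‖ := norm_autL2 _ _ _

theorem S2_of_mem_base {ξ : W.L2} (hξ : ξ ∈ W.L2sub W.base) (t : ℝ) : W.S2 t ξ = ξ := by
  refine L2sub_induction (p := fun ξ => W.S2 t ξ = ξ)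
    (isClosed_eq (by fun_prop) (by fun_prop)) (fun x hx => ?_) hξ
  rw [S2_ι, S_of_mem_base hx]

/-- The shift does not change the `A₀`-component, since it is isometric and fixes `A₀`. -/
theorem condExp_S2 (t : ℝ) (ξ : W.L2) :
    W.condExp W.base (W.S2 t ξ) = W.condExp W.base ξ := by
  refine eq_of_mem_L2sub_of_inner_eq (condExp_mem _ _) (condExp_mem _ _) fun a ha => ?_
  have ha' := ι_mem_L2sub ha
  rw [inner_condExp_of_mem ha', inner_condExp_of_mem ha', ← inner_S2 t (W.ι a) ξ,
    S2_of_mem_base ha']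

theorem base_le_sub {I : Set ℝ} (hI : IsInterval I) {x : W.A} (hx : x ∈ W.sub W.base) :
    x ∈ W.sub (W.filt I) := W.base_le_filt I hI hx

theorem L2sub_base_le {I : Set ℝ} (hI : IsInterval I) {ξ : W.L2} (hξ : ξ ∈ W.L2sub W.base) :
    ξ ∈ W.L2sub (W.filt I) :=
  L2sub_induction (p := (· ∈ W.L2sub (W.filt I))) (Submodule.isClosed_topologicalClosure _)
    (fun _ hx => ι_mem_L2sub (base_le_sub hI hx)) hξ

theorem S_mem_filt {s t : ℝ} (hs : 0 ≤ s) {x : W.A} (hx : x ∈ W.sub (W.filt (Set.Icc 0 s))) :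
    W.S t x ∈ W.sub (W.filt (Set.Icc t (s + t))) := by
  have := (W.filt_shift t _ (isInterval_Icc hs) x).2 hx
  rwa [Set.image_add_const_Icc, zero_add] at this

theorem S2_mem_filt {s t : ℝ} (hs : 0 ≤ s) {ξ : W.L2} (hξ : ξ ∈ W.L2sub (W.filt (Set.Icc 0 s))) :
    W.S2 t ξ ∈ W.L2sub (W.filt (Set.Icc t (s + t))) := by
  refine L2sub_induction
    ((Submodule.isClosed_topologicalClosure _).preimage (W.S2 t).continuous) (fun x hx => ?_) hξ
  rw [S2_ι]
  exact ι_mem_L2sub (S_mem_filt hs hx)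

/-- The past up to time `s` and the future from `s` on are independent over `A₀`. -/
theorem inner_past_future {s r : ℝ} (hs : 0 ≤ s) (hr : s ≤ r) {ξ η : W.L2}
    (hξ : ξ ∈ W.L2sub (W.filt (Set.Icc 0 s))) (hη : η ∈ W.L2sub (W.filt (Set.Icc s r))) :
    ⟪ξ, η⟫_ℂ = ⟪ξ, W.condExp W.base η⟫_ℂ := by
  have hI : interior (Set.Icc 0 s) ∩ interior (Set.Icc s r) = ∅ := by
    rw [interior_Icc, interior_Icc]
    ext x
    simp only [Set.mem_inter_iff, Set.mem_Ioo, Set.mem_empty_iff_false, iff_false]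
    intro h
    linarith [h.1.2, h.2.1]
  have h := W.independent _ _ (isInterval_Icc hs) (isInterval_Icc hr) hI
  rw [← h, ContinuousLinearMap.comp_apply, inner_condExp_of_mem hξ, condExp_of_mem hη]

/-! ### Additive cocycles: drift and martingale part -/

variable {b : ℝ → W.L2}

/-- The drift of an additive cocycle. -/
noncomputable def drift (b : ℝ → W.L2) : W.L2 := W.condExp W.base (b 1)

theorem drift_mem (b : ℝ → W.L2) : drift b ∈ W.L2sub W.base := condExp_mem _ _

namespace IsAdditiveCocycle

theorem zero (hb : W.IsAdditiveCocycle b) : b 0 = 0 := by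
  simpa [S2_zero] using hb.cocycle 0 0 le_rfl le_rfl

theorem condExp_eq (hb : W.IsAdditiveCocycle b) {t : ℝ} (ht : 0 ≤ t) :
    W.condExp W.base (b t) = t • drift b := by
  refine eq_smul_of_additive (f := fun t => W.condExp W.base (b t))
    ((W.condExp W.base).continuous.comp_continuousOn hb.continuous) (fun s t hs ht => ?_) ht
  rw [hb.cocycle s t hs ht, map_add, condExp_S2]

theorem sub_eq (hb : W.IsAdditiveCocycle b) {s r : ℝ} (hs : 0 ≤ s) (hr : s ≤ r) :
    b r - b s = W.S2 s (b (r - s)) := by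
  rw [sub_eq_iff_eq_add, ← hb.cocycle _ _ (sub_nonneg.2 hr) hs, sub_add_cancel]

theorem norm_sub (hb : W.IsAdditiveCocycle b) {s r : ℝ} (hs : 0 ≤ s) (hr : s ≤ r) :
    ‖b r - b s‖ = ‖b (r - s)‖ := by
  rw [hb.sub_eq hs hr, norm_S2]

theorem sub_mem (hb : W.IsAdditiveCocycle b) {s r : ℝ} (hs : 0 ≤ s) (hr : s ≤ r) :
    b r - b s ∈ W.L2sub (W.filt (Set.Icc s r)) := by
  rw [hb.sub_eq hs hr]
  simpa using S2_mem_filt (t := s) (sub_nonneg.2 hr) (hb.adapted (r - s) (sub_nonneg.2 hr))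

theorem condExp_sub (hb : W.IsAdditiveCocycle b) {s r : ℝ} (hs : 0 ≤ s) (hr : s ≤ r) :
    W.condExp W.base (b r - b s) = (r - s) • drift b := by
  rw [hb.sub_eq hs hr, condExp_S2, hb.condExp_eq (sub_nonneg.2 hr)]

/-- The increments of the martingale part are orthogonal, hence its variance is linear. -/
theorem norm_sq_martingale (hb : W.IsAdditiveCocycle b) {t : ℝ} (ht : 0 ≤ t) :
    ‖b t - t • drift b‖ ^ 2 = t * ‖b 1 - drift b‖ ^ 2 := by
  have h := eq_smul_of_additive (f := fun t => ‖b t - t • drift b‖ ^ 2) ?_ ?_ ht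
  · simpa using h
  · exact ((hb.continuous.sub (by fun_prop)).norm).pow 2
  · intro s t hs ht
    have e : b (s + t) - (s + t) • drift b
        = W.S2 t (b s - s • drift b) + (b t - t • drift b) := by
      have : W.S2 t (s • drift b) = s • drift b := S2_of_mem_base
        (Submodule.smul_of_tower_mem _ s (drift_mem b)) t
      rw [hb.cocycle s t hs ht, map_sub, this, add_smul]
      abel
    have hm : ∀ r, 0 ≤ r → b r - r • drift b ∈ W.L2sub (W.filt (Set.Icc 0 r)) := fun r hr =>
      Submodule.sub_mem _ (hb.adapted r hr)
        (L2sub_base_le (isInterval_Icc hr) (Submodule.smul_of_tower_mem _ r (drift_mem b)))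
    have hE : W.condExp W.base (W.S2 t (b s - s • drift b)) = 0 := by
      rw [condExp_S2, map_sub, hb.condExp_eq hs,
        condExp_of_mem (Submodule.smul_of_tower_mem _ s (drift_mem b)), sub_self]
    have horth : ⟪b t - t • drift b, W.S2 t (b s - s • drift b)⟫_ℂ = 0 := by
      rw [inner_past_future ht (by linarith) (hm t ht) (S2_mem_filt hs (hm s hs)), hE,
        inner_zero_right]
    simp only [e]
    rw [add_comm, @norm_add_sq ℂ, horth, norm_S2]
    simp [add_comm]

theorem norm_sq_eq (hb : W.IsAdditiveCocycle b) {t : ℝ} (ht : 0 ≤ t) :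
    ‖b t‖ ^ 2 = t ^ 2 * ‖drift b‖ ^ 2 + t * ‖b 1 - drift b‖ ^ 2 := by
  have e : b t = t • drift b + (b t - t • drift b) := by abel
  have h : ⟪t • drift b, b t - t • drift b⟫_ℂ = 0 := by
    have hd : t • drift b ∈ W.L2sub W.base := Submodule.smul_of_tower_mem _ t (drift_mem b)
    rw [← inner_condExp_of_mem hd, map_sub, hb.condExp_eq ht, condExp_of_mem hd, sub_self,
      inner_zero_right]
  rw [e, @norm_add_sq ℂ, h, hb.norm_sq_martingale ht, norm_smul, mul_pow]
  simp

theorem eq_smul (hb : W.IsAdditiveCocycle b) (h : b 1 = drift b) {t : ℝ} (ht : 0 ≤ t) :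
    b t = t • drift b := by
  have := hb.norm_sq_martingale ht
  rw [h, sub_self, norm_zero, zero_pow two_ne_zero, mul_zero] at this
  exact sub_eq_zero.1 (norm_eq_zero.1 (pow_eq_zero_iff two_ne_zero |>.1 this))

end IsAdditiveCocycle

/-- The difference quotients at `0` of a weakly differentiable family are bounded along `1 / n`,
by the uniform boundedness principle. -/
theorem WeaklyDifferentiableAtZero.exists_bound {f : ℝ → W.L2}
    (hf : W.WeaklyDifferentiableAtZero f) :
    ∃ C, ∀ n : ℕ, ‖f (1 / (n + 1 : ℝ)) - f 0‖ ≤ C / (n + 1) := by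
  let g : ℕ → W.L2 := fun n => (n + 1 : ℝ) • (f (1 / (n + 1 : ℝ)) - f 0)
  have hb : ∀ ξ : W.L2, ∃ C, ∀ n, ‖innerSL ℂ (g n) ξ‖ ≤ C := by
    intro ξ
    obtain ⟨d, hd⟩ := hf ξ
    have hd' : HasDerivWithinAt (fun t => ⟪ξ, f t⟫_ℂ) (d 1) (Set.Ici 0) 0 :=
      hd.hasDerivWithinAt
    rw [hasDerivWithinAt_iff_tendsto_slope] at hd'
    have hs : Tendsto (fun n : ℕ => 1 / (n + 1 : ℝ)) atTop (𝓝[Set.Ici 0 \ {0}] 0) := by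
      refine tendsto_nhdsWithin_iff.2 ⟨tendsto_one_div_add_atTop_nhds_zero_nat,
        Eventually.of_forall fun n => ⟨?_, ?_⟩⟩
      · exact (Nat.one_div_pos_of_nat (α := ℝ)).le
      · exact (Nat.one_div_pos_of_nat (α := ℝ)).ne'
    obtain ⟨C, hC⟩ := (hd'.comp hs).norm.bddAbove_range
    refine ⟨C, fun n => le_of_eq_of_le ?_ (hC ⟨n, rfl⟩)⟩
    have hn : (0 : ℝ) < n + 1 := by positivity
    simp only [innerSL_apply_apply, g, Function.comp, slope, vsub_eq_sub, sub_zero, one_div,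
      inv_inv]
    rw [norm_inner_symm, ← inner_sub_right, ← Complex.coe_smul, inner_smul_right, norm_smul,
      norm_mul, Complex.norm_real]
  obtain ⟨C, hC⟩ := banach_steinhaus hb
  refine ⟨C, fun n => ?_⟩
  have hn : (0 : ℝ) < n + 1 := by positivity
  have := hC n
  rw [innerSL_apply_norm, norm_smul, Real.norm_of_nonneg hn.le] at this
  rw [le_div_iff₀ hn, mul_comm]
  exact this

namespace IsAdditiveCocycle

/-- A weakly differentiable additive cocycle has no martingale part. -/
theorem eq_drift_of_differentiable (hb : W.IsAdditiveCocycle b)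
    (hd : W.WeaklyDifferentiableAtZero b) : b 1 = drift b := by
  obtain ⟨C, hC⟩ := hd.exists_bound
  rw [hb.zero] at hC
  have key : ∀ n : ℕ, (n + 1 : ℝ) * ‖b 1 - drift b‖ ^ 2 ≤ C ^ 2 := by
    intro n
    have hn : (0 : ℝ) < n + 1 := by positivity
    have h1 := pow_le_pow_left₀ (norm_nonneg _) (hC n) 2
    rw [sub_zero, hb.norm_sq_eq (by positivity), div_pow C, le_div_iff₀ (by positivity)] at h1
    have e : ((1 / (n + 1 : ℝ)) ^ 2 * ‖drift b‖ ^ 2 + 1 / (n + 1 : ℝ) * ‖b 1 - drift b‖ ^ 2) *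
        (n + 1 : ℝ) ^ 2 = ‖drift b‖ ^ 2 + (n + 1 : ℝ) * ‖b 1 - drift b‖ ^ 2 := by
      field_simp
    rw [e] at h1
    nlinarith [sq_nonneg ‖drift b‖]
  by_contra hne
  have hpos : 0 < ‖b 1 - drift b‖ ^ 2 := by
    have : 0 < ‖b 1 - drift b‖ := norm_pos_iff.2 (sub_ne_zero.2 hne)
    positivity
  obtain ⟨n, hn⟩ := exists_nat_gt (C ^ 2 / ‖b 1 - drift b‖ ^ 2)
  rw [div_lt_iff₀ hpos] at hn
  nlinarith [key n]

end IsAdditiveCocycle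

/-! ### The structure equation -/

theorem isSubdivision_uniform {t : ℝ} (ht : 0 < t) (N : ℕ) :
    IsSubdivision t (N + 1) fun j => j * t / (N + 1 : ℕ) where
  zero := by simp
  last := by field_simp
  lt j _ := by
    have : (0 : ℝ) < (N + 1 : ℕ) := by positivity
    push_cast
    gcongr
    linarith

theorem mesh_uniform (t : ℝ) (N j : ℕ) :
    ((j + 1 : ℕ) : ℝ) * t / (N + 1 : ℕ) - j * t / (N + 1 : ℕ) = t / (N + 1 : ℕ) := by
  push_cast; ring

/-- The quadratic variation is computed by the uniform subdivisions. -/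
theorem IsQuadVar.tendsto {t : ℝ} (ht : 0 < t) {q : W.L1} (hq : W.IsQuadVar b t q) :
    Tendsto (fun N : ℕ => ∑ j ∈ Finset.range (N + 1),
      W.starMul (b (((j + 1 : ℕ) : ℝ) * t / (N + 1 : ℕ)) - b (j * t / (N + 1 : ℕ)))
        (b (((j + 1 : ℕ) : ℝ) * t / (N + 1 : ℕ)) - b (j * t / (N + 1 : ℕ)))) atTop (𝓝 q) := by
  rw [Metric.tendsto_atTop]
  intro ε hε
  obtain ⟨δ, hδ, h⟩ := hq ε hε
  have h0 : Tendsto (fun N : ℕ => t / (N + 1 : ℕ)) atTop (𝓝 0) :=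
    (tendsto_const_div_atTop_nhds_zero_nat t).comp (tendsto_add_atTop_nat 1)
  obtain ⟨N₀, hN⟩ := eventually_atTop.1 (h0.eventually_lt_const hδ)
  refine ⟨N₀, fun N hN' => ?_⟩
  rw [dist_eq_norm]
  refine h (N + 1) (fun j => j * t / (N + 1 : ℕ)) (isSubdivision_uniform ht N) fun j _ => ?_
  rw [mesh_uniform]
  exact hN N hN'

namespace IsAdditiveData

/-- The trace of the structure equation at time `1`. -/
theorem norm_sq_sub_drift (hb : W.IsAdditiveData b) :
    ‖b 1 - drift b‖ ^ 2 = -2 * (⟪W.ι 1, drift b⟫_ℂ).re := by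
  obtain ⟨q, hq, hs⟩ := hb.structure_equation 1 zero_le_one
  have hc := hb.toIsAdditiveCocycle
  -- the sums of the traces converge both to `q 1` and to the variance of the martingale part
  have h1 := ((ContinuousLinearMap.apply ℂ ℂ (1 : W.A)).continuous.tendsto q).comp
    (hq.tendsto one_pos)
  have e : ∀ N : ℕ, (∑ j ∈ Finset.range (N + 1),
      W.starMul (b (((j + 1 : ℕ) : ℝ) * 1 / (N + 1 : ℕ)) - b (j * 1 / (N + 1 : ℕ)))
        (b (((j + 1 : ℕ) : ℝ) * 1 / (N + 1 : ℕ)) - b (j * 1 / (N + 1 : ℕ)))) 1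
      = ((1 / (N + 1 : ℕ) * ‖drift b‖ ^ 2 + ‖b 1 - drift b‖ ^ 2 : ℝ) : ℂ) := by
    intro N
    have hN : (0 : ℝ) < (N + 1 : ℕ) := by positivity
    rw [sum_apply]
    have : ∀ j ∈ Finset.range (N + 1),
        W.starMul (b (((j + 1 : ℕ) : ℝ) * 1 / (N + 1 : ℕ)) - b (j * 1 / (N + 1 : ℕ)))
        (b (((j + 1 : ℕ) : ℝ) * 1 / (N + 1 : ℕ)) - b (j * 1 / (N + 1 : ℕ))) 1
        = ((((1 / (N + 1 : ℕ)) ^ 2 * ‖drift b‖ ^ 2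
            + 1 / (N + 1 : ℕ) * ‖b 1 - drift b‖ ^ 2 : ℝ)) : ℂ) := by
      intro j _
      rw [starMul_apply, rightMul_one, inner_self_eq_norm_sq_to_K,
        hc.norm_sub (by positivity) (by push_cast; gcongr; linarith), mesh_uniform,
        ← hc.norm_sq_eq (by positivity)]
      simp
    rw [Finset.sum_congr rfl this, Finset.sum_const, Finset.card_range, nsmul_eq_mul]
    push_cast
    have : ((N : ℂ) + 1) ≠ 0 := by exact_mod_cast hN.ne'
    field_simp
  have h2 : Tendsto (fun N : ℕ =>
      ((1 / (N + 1 : ℕ) * ‖drift b‖ ^ 2 + ‖b 1 - drift b‖ ^ 2 : ℝ) : ℂ)) atTop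
      (𝓝 ((0 * ‖drift b‖ ^ 2 + ‖b 1 - drift b‖ ^ 2 : ℝ) : ℂ)) := by
    refine (Complex.continuous_ofReal.tendsto _).comp (Tendsto.add_const _ (Tendsto.mul_const _ ?_))
    exact (tendsto_const_div_atTop_nhds_zero_nat 1).comp (tendsto_add_atTop_nat 1)
  have h3 : q 1 = ((0 * ‖drift b‖ ^ 2 + ‖b 1 - drift b‖ ^ 2 : ℝ) : ℂ) := by
    refine tendsto_nhds_unique h1 (h2.congr fun N => ?_)
    exact (e N).symm
  have h4 := DFunLike.congr_fun hs 1
  simp only [add_apply, toL1_apply, zero_apply, h3,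
    star_one] at h4
  have h5 : ⟪W.ι 1, W.adj (b 1)⟫_ℂ = star ⟪W.ι 1, b 1⟫_ℂ := by
    have := inner_adj (P := W.toProbSpace) (W.ι 1) (b 1)
    rw [adj_ι, star_one] at this
    rw [this]
    exact (inner_conj_symm _ _).symm
  have h6 : ⟪W.ι 1, b 1⟫_ℂ = ⟪W.ι 1, drift b⟫_ℂ :=
    (inner_condExp_of_mem (ι_mem_L2sub (one_mem _)) _).symm
  rw [h5, h6] at h4
  have h7 := congrArg Complex.re h4
  rw [Complex.add_re, Complex.add_re, Complex.ofReal_re, Complex.star_def, Complex.conj_re,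
    Complex.zero_re] at h7
  linarith

/-- Without martingale part the quadratic variation vanishes, hence the drift is skew adjoint. -/
theorem adj_drift (hb : W.IsAdditiveData b) (h : b 1 = drift b) :
    W.adj (drift b) = -drift b := by
  obtain ⟨q, hq, hs⟩ := hb.structure_equation 1 zero_le_one
  have hc := hb.toIsAdditiveCocycle
  have h0 : Tendsto (fun N : ℕ => 1 / ((N + 1 : ℕ) : ℝ) * ‖drift b‖ ^ 2) atTop
      (𝓝 (0 * ‖drift b‖ ^ 2)) :=
    Tendsto.mul_const _ ((tendsto_const_div_atTop_nhds_zero_nat 1).comp (tendsto_add_atTop_nat 1))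
  rw [zero_mul] at h0
  have hq0 : q = 0 := by
    refine tendsto_nhds_unique (hq.tendsto one_pos) (squeeze_zero_norm (fun N => ?_) h0)
    have hN : (0 : ℝ) < (N + 1 : ℕ) := by positivity
    refine (norm_sum_le _ _).trans ?_
    have : ∀ j ∈ Finset.range (N + 1),
        ‖W.starMul (b (((j + 1 : ℕ) : ℝ) * 1 / (N + 1 : ℕ)) - b (j * 1 / (N + 1 : ℕ)))
        (b (((j + 1 : ℕ) : ℝ) * 1 / (N + 1 : ℕ)) - b (j * 1 / (N + 1 : ℕ)))‖
        ≤ (1 / (N + 1 : ℕ)) ^ 2 * ‖drift b‖ ^ 2 := by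
      intro j _
      refine (norm_starMul_le _ _).trans ?_
      rw [← sq, hc.norm_sub (by positivity) (by push_cast; gcongr; linarith), mesh_uniform,
        hc.norm_sq_eq (by positivity), h]
      simp
    refine (Finset.sum_le_sum this).trans ?_
    rw [Finset.sum_const, Finset.card_range, nsmul_eq_mul]
    apply le_of_eq
    field_simp
  rw [hq0, zero_add, h] at hs
  have : W.toL1 (W.adj (drift b)) = W.toL1 (-drift b) := by
    rw [add_eq_zero_iff_eq_neg] at hs
    rw [hs]
    ext a
    simp [toL1_apply]
  exact toL1_injective this

end IsAdditiveData

end WhiteNoise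

end QSStone

/-! ### Norm continuous semigroups -/

/-- A norm continuous one-parameter semigroup in a Banach algebra is an exponential: dividing by
the invertible element `∫₀^δ e` shows that it is differentiable. -/
theorem exists_eq_exp_of_semigroup {R : Type*} [NormedRing R] [NormedAlgebra ℝ R]
    [CompleteSpace R] {e : ℝ → R} (he : ContinuousOn e (Set.Ici 0)) (h0 : e 0 = 1)
    (hmul : ∀ s t, 0 ≤ s → 0 ≤ t → e (s + t) = e s * e t) :
    ∃ G : R, ∀ t, 0 ≤ t → e t = NormedSpace.exp (t • G) := by
  let g : ℝ → R := fun t => e (max t 0)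
  have hg : Continuous g :=
    he.comp_continuous (by fun_prop) fun x => Set.mem_Ici.2 (le_max_right _ _)
  have ge : ∀ t, 0 ≤ t → g t = e t := fun t ht => by simp only [g, max_eq_left ht]
  let F : ℝ → R := fun t => ∫ s in (0 : ℝ)..t, g s
  have hF : ∀ t, HasDerivAt F (g t) t := fun t =>
    intervalIntegral.integral_hasDerivAt_right (hg.intervalIntegrable _ _)
      (hg.stronglyMeasurableAtFilter _ _) hg.continuousAt
  -- `F δ` is invertible for small `δ > 0`, since `F δ / δ → 1`
  obtain ⟨δ, hδ, hu⟩ : ∃ δ : ℝ, 0 < δ ∧ IsUnit (F δ) := by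
    have h1 : Tendsto (slope F 0) (𝓝[>] 0) (𝓝 1) := by
      have h := (hasDerivAt_iff_tendsto_slope.1 (hF 0)).mono_left
        (nhdsWithin_mono 0 (fun x (hx : 0 < x) => hx.ne'))
      rwa [ge 0 le_rfl, h0] at h
    have h2 : ∀ᶠ t in 𝓝[>] (0 : ℝ), IsUnit (slope F 0 t) :=
      h1.eventually (Units.isOpen.mem_nhds isUnit_one)
    obtain ⟨t, ht, ht0⟩ := (h2.and self_mem_nhdsWithin).exists
    refine ⟨t, ht0, ?_⟩
    have hF0 : F 0 = 0 := intervalIntegral.integral_same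
    rw [slope_def_module, sub_zero, hF0, sub_zero] at ht
    have e : F t = algebraMap ℝ R t * (t⁻¹ • F t) := by
      rw [← Algebra.smul_def, smul_inv_smul₀ (ne_of_gt ht0)]
    rw [e]
    exact ((IsUnit.mk0 t (ne_of_gt ht0)).map (algebraMap ℝ R)).mul ht
  obtain ⟨w, hw⟩ := hu
  have hFi : F δ * ↑w⁻¹ = 1 := by rw [← hw, Units.mul_inv]
  have key : ∀ t, 0 ≤ t → e t = (F (t + δ) - F t) * ↑w⁻¹ := by
    intro t ht
    have h1 : e t * F δ = F (t + δ) - F t := by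
      have h2 : F (t + δ) - F t = ∫ s in t..t + δ, g s :=
        intervalIntegral.integral_interval_sub_left (hg.intervalIntegrable _ _)
          (hg.intervalIntegrable _ _)
      have h3 : ∫ s in (0 : ℝ)..δ, e t * g s = ∫ s in (0 : ℝ)..δ, g (t + s) := by
        refine intervalIntegral.integral_congr fun s hs => ?_
        rw [Set.uIcc_of_le hδ.le] at hs
        rw [ge s hs.1, ge (t + s) (add_nonneg ht hs.1), hmul t s ht hs.1]
      have h4 : ∫ s in (0 : ℝ)..δ, e t * g s = e t * F δ :=
        (ContinuousLinearMap.mul ℝ R (e t)).intervalIntegral_comp_comm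
          (hg.intervalIntegrable _ _)
      rw [h2, ← h4, h3, intervalIntegral.integral_comp_add_left, add_zero]
    rw [← h1, mul_assoc, hFi, mul_one]
  let G : R := (e δ - 1) * ↑w⁻¹
  let p : ℝ → R := fun t => (F (t + δ) - F t) * ↑w⁻¹ * NormedSpace.exp (t • (-G))
  have hp : ∀ t, HasDerivAt p ((g (t + δ) - g t) * ↑w⁻¹ * NormedSpace.exp (t • (-G)) +
      (F (t + δ) - F t) * ↑w⁻¹ * (-G * NormedSpace.exp (t • (-G)))) t := fun t =>
    ((((hF (t + δ)).comp_add_const t δ).sub (hF t)).mul_const _).mul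
      (hasDerivAt_exp_smul_const' (-G) t)
  have hp0 : ∀ t, 0 ≤ t → HasDerivAt p 0 t := by
    intro t ht
    convert hp t using 1
    rw [← key t ht, ge (t + δ) (by positivity), ge t ht, hmul t δ ht hδ.le]
    simp only [G]
    noncomm_ring
  refine ⟨G, fun t ht => ?_⟩
  have h1 := constant_of_has_deriv_right_zero (f := p) (a := 0) (b := t)
    (fun x _ => (hp x).continuousAt.continuousWithinAt)
    (fun x hx => (hp0 x hx.1).hasDerivWithinAt) t (Set.right_mem_Icc.2 ht)
  have h2 : e t * NormedSpace.exp (t • (-G)) = 1 := by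
    have h3 : p 0 = 1 := by
      simp only [p]
      rw [← key 0 le_rfl, h0]; simp
    rw [h3] at h1
    rw [← h1, key t ht]
  have h4 : NormedSpace.exp (t • (-G)) * NormedSpace.exp (t • G) = 1 := by
    let _ : NormedAlgebra ℚ R := NormedAlgebra.restrictScalars ℚ ℝ R
    rw [smul_neg, ← NormedSpace.exp_add_of_commute (Commute.refl _).neg_left, neg_add_cancel,
      NormedSpace.exp_zero]
  calc e t = e t * (NormedSpace.exp (t • (-G)) * NormedSpace.exp (t • G)) := by rw [h4, mul_one]
    _ = _ := by rw [← mul_assoc, h2, one_mul]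

/-- The generator of the semigroup `exp (t G)`, computed along `1 / N`. -/
theorem tendsto_nat_smul_exp_sub_one {R : Type*} [NormedRing R] [NormedAlgebra ℝ R]
    [CompleteSpace R] (G : R) (t : ℝ) :
    Tendsto (fun N : ℕ => (N : ℝ) • (NormedSpace.exp ((t / N) • G) - 1)) atTop (𝓝 (t • G)) := by
  have h := hasDerivAt_exp_smul_const (t • G) (0 : ℝ)
  rw [hasDerivAt_iff_tendsto_slope, zero_smul, NormedSpace.exp_zero, one_mul] at h
  have h1 : Tendsto (fun N : ℕ => (N : ℝ)⁻¹) atTop (𝓝[≠] 0) := by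
    refine tendsto_nhdsWithin_iff.2 ⟨tendsto_inv_atTop_nhds_zero_nat, ?_⟩
    filter_upwards [eventually_gt_atTop 0] with N hN
    have : (0 : ℝ) < N := by exact_mod_cast hN
    exact (inv_pos.2 this).ne'
  refine (h.comp h1).congr fun N => ?_
  simp only [Function.comp, slope, vsub_eq_sub, sub_zero, inv_inv, zero_smul,
    NormedSpace.exp_zero]
  rw [smul_smul, div_eq_inv_mul]

/-! ### Invertibility in C⋆-algebras -/

section CStar

variable {T : Type*} [CStarAlgebra T] [PartialOrder T] [StarOrderedRing T]

/-- The resolvent `(1 + x)⁻¹` of a skew adjoint element is a contraction. -/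
theorem exists_resolvent {x : T} (hx : star x = -x) :
    ∃ v : T, ‖v‖ ≤ 1 ∧ v * (1 + x) = 1 ∧ (1 + x) * v = 1 := by
  have h1 : (1 : T) ≤ star (1 + x) * (1 + x) := by
    have : star (1 + x) * (1 + x) = 1 + star x * x := by rw [star_add, hx, star_one]; noncomm_ring
    rw [this]
    exact le_add_of_nonneg_right (star_mul_self_nonneg x)
  have h2 : IsUnit (star (1 + x) * (1 + x)) :=
    CStarAlgebra.isUnit_of_le 1 h1 isStrictlyPositive_one
  have hc : Commute (star (1 + x)) (1 + x) := by
    rw [star_add, hx, star_one]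
    change (1 + -x) * (1 + x) = (1 + x) * (1 + -x)
    noncomm_ring
  obtain ⟨v, hv⟩ := ((hc.isUnit_mul_iff).1 h2).2
  refine ⟨↑v⁻¹, ?_, by rw [← hv]; simp, by rw [← hv]; simp⟩
  have h3 := star_left_conjugate_le_conjugate h1 (↑v⁻¹ : T)
  have h4 : star (↑v⁻¹ : T) * (star (1 + x) * (1 + x)) * ↑v⁻¹ = 1 := by
    rw [← hv, mul_assoc, mul_assoc, Units.mul_inv, mul_one, ← star_mul, Units.mul_inv, star_one]
  rw [h4, mul_one] at h3
  have h5 : ‖star (↑v⁻¹ : T) * ↑v⁻¹‖ ≤ 1 :=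
    (CStarAlgebra.norm_le_one_iff_of_nonneg _ (star_mul_self_nonneg _)).2 h3
  rw [CStarRing.norm_star_mul_self] at h5
  nlinarith [norm_nonneg (↑v⁻¹ : T)]

/-- A selfadjoint element which a faithful positive functional sees as bounded below is
invertible. -/
theorem isUnit_of_faithful_bound (f : T →ₗ[ℂ] ℂ) (hpos : ∀ y, 0 ≤ f (star y * y))
    (hf : ∀ y, f (star y * y) = 0 → y = 0) {w : T} (hw : IsSelfAdjoint w) {c : ℝ} (hc : 0 < c)
    (h : ∀ y, c * (f (star y * y)).re ≤ (f (star y * w * y)).re) : IsUnit w := by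
  have hcw : algebraMap ℝ T c ≤ w := by
    set z : T := w - algebraMap ℝ T c with hz
    have hzsa : IsSelfAdjoint z := hw.sub (IsSelfAdjoint.algebraMap T (.all c))
    obtain ⟨d, hd⟩ := CStarAlgebra.nonneg_iff_eq_star_mul_self.1 (CFC.negPart_nonneg z)
    have hN : IsSelfAdjoint z⁻ := IsSelfAdjoint.of_nonneg (CFC.negPart_nonneg z)
    have e1 : star z⁻ * z * z⁻ = -(star (d * z⁻) * (d * z⁻)) := by
      have h1 : z * z⁻ = -(z⁻ * z⁻) := by
        calc z * z⁻ = (z⁺ - z⁻) * z⁻ := by rw [CFC.posPart_sub_negPart z hzsa]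
          _ = -(z⁻ * z⁻) := by rw [sub_mul, CFC.posPart_mul_negPart, zero_sub]
      have h2 : star (d * z⁻) * (d * z⁻) = star z⁻ * (star d * d) * z⁻ := by
        rw [star_mul]; simp only [mul_assoc]
      rw [h2, ← hd, mul_assoc, h1, mul_neg, mul_assoc]
    have h2 : 0 ≤ (f (star z⁻ * z * z⁻)).re := by
      have e2 : star z⁻ * z * z⁻ = star z⁻ * w * z⁻ - (c : ℂ) • (star z⁻ * z⁻) := by
        rw [hz, mul_sub, sub_mul, ← Algebra.commutes, Algebra.algebraMap_eq_smul_one]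
        simp
      rw [e2, map_sub, map_smul, Complex.sub_re, smul_eq_mul, Complex.re_ofReal_mul]
      linarith [h z⁻]
    rw [e1, map_neg, Complex.neg_re] at h2
    have h3 := hpos (d * z⁻)
    have h4 : d * z⁻ = 0 := hf _ (le_antisymm (by
      rw [Complex.le_def] at h3 ⊢
      exact ⟨by simpa using h2, h3.2.symm⟩) h3)
    have h5 : z⁻ = 0 := by
      have : z⁻ * z⁻ = 0 := by
        calc z⁻ * z⁻ = star d * (d * z⁻) := by rw [← mul_assoc, ← hd]
          _ = 0 := by rw [h4, mul_zero]
      rw [← CStarRing.star_mul_self_eq_zero_iff, hN.star_eq, this]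
    have h6 : 0 ≤ z := by
      rw [← CFC.posPart_sub_negPart z hzsa, h5, sub_zero]
      exact CFC.posPart_nonneg z
    exact sub_nonneg.1 h6
  exact CStarAlgebra.isUnit_of_le _ hcw (isStrictlyPositive_algebraMap hc)

end CStar

namespace QSStone

universe u

variable {H : Type u} [NormedAddCommGroup H] [InnerProductSpace ℂ H] [CompleteSpace H]

/-! ### Weak limits of bounded families of operators -/

/-- Bounded families of operators converge weakly along ultrafilters. -/
theorem exists_weak_limit {α : Type*} (F : Ultrafilter α) {x : α → H →L[ℂ] H} {C : ℝ}
    (hx : ∀ i, ‖x i‖ ≤ C) :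
    ∃ w : H →L[ℂ] H, ∀ ξ η : H, Tendsto (fun i => ⟪ξ, x i η⟫_ℂ) F (𝓝 ⟪ξ, w η⟫_ℂ) := by
  have hb : ∀ ξ η i, ‖⟪x i ξ, η⟫_ℂ‖ ≤ C * ‖ξ‖ * ‖η‖ := fun ξ η i =>
    (norm_inner_le_norm _ _).trans (by gcongr; exact (x i).le_of_opNorm_le (hx i) ξ)
  have hlim : ∀ ξ η, ∃ z : ℂ, Tendsto (fun i => ⟪x i ξ, η⟫_ℂ) F (𝓝 z) ∧
      ‖z‖ ≤ C * ‖ξ‖ * ‖η‖ := by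
    intro ξ η
    obtain ⟨z, hz, h⟩ := (isCompact_closedBall (0 : ℂ) (C * ‖ξ‖ * ‖η‖)).ultrafilter_le_nhds
      (F.map fun i => ⟪x i ξ, η⟫_ℂ) (le_principal_iff.2 (Ultrafilter.mem_map.2
        (Eventually.of_forall fun i => by simpa using hb ξ η i)))
    exact ⟨z, h, by simpa using hz⟩
  choose B hB hBn using hlim
  let B₀ : H →ₗ⋆[ℂ] H →ₗ[ℂ] ℂ := LinearMap.mk₂'ₛₗ (starRingEnd ℂ) (RingHom.id ℂ) B
    (fun ξ ξ' η => tendsto_nhds_unique (hB _ _)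
      (((hB ξ η).add (hB ξ' η)).congr fun i => by rw [map_add, inner_add_left]))
    (fun c ξ η => tendsto_nhds_unique (hB _ _)
      (((hB ξ η).const_mul (starRingEnd ℂ c)).congr fun i => by rw [map_smul, inner_smul_left]))
    (fun ξ η η' => tendsto_nhds_unique (hB _ _)
      (((hB ξ η).add (hB ξ η')).congr fun i => by rw [inner_add_right]))
    (fun c ξ η => tendsto_nhds_unique (hB _ _)
      (((hB ξ η).const_mul c).congr fun i => by rw [inner_smul_right]))
  let w := InnerProductSpace.continuousLinearMapOfBilin (𝕜 := ℂ) (B₀.mkContinuous₂ C hBn)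
  have hw : ∀ ξ η, ⟪w ξ, η⟫_ℂ = B ξ η := fun ξ η =>
    InnerProductSpace.continuousLinearMapOfBilin_apply _ ξ η
  refine ⟨w, fun ξ η => ?_⟩
  have h := (Complex.continuous_conj.tendsto _).comp (hB η ξ)
  rw [← hw, inner_conj_symm] at h
  exact h.congr fun i => inner_conj_symm _ _

/-- Von Neumann algebras are closed under weak limits. -/
theorem mem_of_weak_limit {B : VonNeumannAlgebra H} {α : Type*} {l : Filter α} [l.NeBot]
    {x : α → H →L[ℂ] H} {w : H →L[ℂ] H} (hx : ∀ i, x i ∈ B)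
    (hw : ∀ ξ η : H, Tendsto (fun i => ⟪ξ, x i η⟫_ℂ) l (𝓝 ⟪ξ, w η⟫_ℂ)) : w ∈ B := by
  rw [← B.commutant_commutant, VonNeumannAlgebra.mem_commutant_iff]
  intro g hg
  rw [VonNeumannAlgebra.mem_commutant_iff] at hg
  ext η
  refine ext_inner_left ℂ fun ξ => ?_
  change ⟪ξ, g (w η)⟫_ℂ = ⟪ξ, w (g η)⟫_ℂ
  rw [← ContinuousLinearMap.adjoint_inner_left]
  refine tendsto_nhds_unique (hw _ _) ((hw ξ (g η)).congr fun i => ?_)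
  rw [ContinuousLinearMap.adjoint_inner_left]
  exact congrArg (fun y : H →L[ℂ] H => ⟪ξ, y η⟫_ℂ) (hg _ (hx i))

namespace ProbSpace

variable {P : ProbSpace H}

/-- Norm bounded sets of a von Neumann subalgebra are complete for the `L²`-norm. -/
theorem exists_ι_eq_of_tendsto {B : VonNeumannAlgebra H} (hB : B ≤ P.alg) {x : ℕ → P.A} {C : ℝ}
    (hx : ∀ n, ‖x n‖ ≤ C) (hxB : ∀ n, x n ∈ P.sub B) {ζ : P.L2}
    (h : Tendsto (fun n => P.ι (x n)) atTop (𝓝 ζ)) : ∃ w ∈ P.sub B, P.ι w = ζ := by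
  let F : Ultrafilter ℕ := Ultrafilter.of atTop
  have hF : (F : Filter ℕ) ≤ atTop := Ultrafilter.of_le atTop
  obtain ⟨w₀, hw⟩ := exists_weak_limit F (x := fun n => (x n).op) hx
  have hwB : w₀ ∈ B := mem_of_weak_limit hxB hw
  let w : P.A := ⟨w₀, hB hwB⟩
  refine ⟨w, hwB, eq_of_inner_ι_eq fun a => ?_⟩
  have h1 : Tendsto (fun n => ⟪P.ι a, P.ι (x n)⟫_ℂ) F (𝓝 ⟪P.ι a, ζ⟫_ℂ) :=
    tendsto_const_nhds.inner (h.mono_left hF)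
  have h2 : Tendsto (fun n => P.τ (star a * x n)) F (𝓝 (P.τ (star a * w))) :=
    (P.τ_normal.comp_mul_left (star a)).tendsto hx hw
  rw [inner_ι]
  exact tendsto_nhds_unique h2 (h1.congr fun n => inner_ι _ _ _)

/-- On norm bounded sets, `L²`-convergence implies strong convergence on `L²(A, τ)`. -/
theorem tendsto_leftMul {x : ℕ → P.A} {C : ℝ} (hx : ∀ n, ‖x n‖ ≤ C) {w : P.A}
    (h : Tendsto (fun n => P.ι (x n)) atTop (𝓝 (P.ι w))) {ζ : ℕ → P.L2} {ζ₀ : P.L2}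
    (hζ : Tendsto ζ atTop (𝓝 ζ₀)) :
    Tendsto (fun n => P.leftMul (x n) (ζ n)) atTop (𝓝 (P.leftMul w ζ₀)) := by
  have h1 : Tendsto (fun n => P.leftMul (x n) ζ₀) atTop (𝓝 (P.leftMul w ζ₀)) := by
    clear hζ
    induction ζ₀ using L2_induction with
    | hp =>
      have he : Equicontinuous fun (n : ℕ) (ζ : P.L2) => P.leftMul (x n) ζ :=
        ((NormedSpace.equicontinuous_TFAE fun n => P.leftMul (x n)).out 1 5).2
          (show ∃ C, ∀ n, ‖P.leftMul (x n)‖ ≤ C from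
            ⟨C, fun n => (P.norm_leftMul_le _).trans (hx n)⟩)
      exact he.isClosed_setOfPred_tendsto (P.leftMul w).continuous
    | h a =>
      have h2 := ((P.rightMul a).continuous.tendsto _).comp h
      rw [rightMul_ι] at h2
      rw [leftMul_ι]
      exact h2.congr fun n => by simp [leftMul_ι, rightMul_ι]
  have h2 : Tendsto (fun n => P.leftMul (x n) (ζ n - ζ₀)) atTop (𝓝 0) := by
    have h3 : Tendsto (fun n => C * ‖ζ n - ζ₀‖) atTop (𝓝 (C * ‖ζ₀ - ζ₀‖)) :=
      ((hζ.sub_const ζ₀).norm).const_mul C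
    rw [sub_self, norm_zero, mul_zero] at h3
    refine squeeze_zero_norm (fun n => ?_) h3
    exact (norm_leftMul_apply_le _ _).trans (by gcongr; exact hx n)
  have h3 := h2.add h1
  rw [zero_add] at h3
  exact h3.congr fun n => by rw [← map_add, sub_add_cancel]

theorem tendsto_rightMul {x : ℕ → P.A} {C : ℝ} (hx : ∀ n, ‖x n‖ ≤ C) {w : P.A}
    (h : Tendsto (fun n => P.ι (x n)) atTop (𝓝 (P.ι w))) {ζ : ℕ → P.L2} {ζ₀ : P.L2}
    (hζ : Tendsto ζ atTop (𝓝 ζ₀)) :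
    Tendsto (fun n => P.rightMul (x n) (ζ n)) atTop (𝓝 (P.rightMul w ζ₀)) := by
  have hc := P.adj.continuous
  have h1 := (hc.tendsto _).comp h
  rw [adj_ι] at h1
  exact (hc.tendsto _).comp (tendsto_leftMul (x := fun n => star (x n)) (C := C)
    (fun n => by rw [norm_star]; exact hx n) (h1.congr fun n => adj_ι _ _)
    ((hc.tendsto _).comp hζ))

/-! ### Bounded skew adjoint elements of `L²` lie in the algebra -/

/-- A skew adjoint `k ∈ L²(B, τ)` such that `y ↦ k y` is bounded in `‖·‖₂` on `B` lies in `B`.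
The resolvents of skew adjoint elements of `B` approximating `k` are `L²`-Cauchy contractions;
their limit is an inverse `w` of `1 + k`, and the boundedness of `k` makes `w` invertible
in `B`. -/
theorem exists_ι_eq_of_bounded {B : VonNeumannAlgebra H} (hB : B ≤ P.alg) {k : P.L2}
    (hk : k ∈ P.L2sub B) (hadj : P.adj k = -k) {C : ℝ} (hC : 0 ≤ C)
    (hbd : ∀ y ∈ P.sub B, ‖P.rightMul y k‖ ≤ C * ‖P.ι y‖) : ∃ G ∈ P.sub B, P.ι G = k := by
  let _ : PartialOrder (P.sub B) := CStarAlgebra.spectralOrder (P.sub B)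
  have : StarOrderedRing (P.sub B) := CStarAlgebra.spectralOrderedRing (P.sub B)
  obtain ⟨z, hz, hzk⟩ := mem_closure_iff_seq_limit.1 hk
  choose y hy hyz using hz
  -- replace the approximating sequence by its skew adjoint part
  let x : ℕ → P.A := fun n => (1 / 2 : ℂ) • (y n - star (y n))
  have hxB : ∀ n, x n ∈ P.sub B := fun n =>
    (P.sub B).smul_mem (sub_mem (hy n) (star_mem (hy n))) _
  have hxs : ∀ n, star (x n) = -x n := fun n => by
    simp only [x, star_smul, star_sub, star_star, ← smul_neg, neg_sub]
    simp
  have hxk : Tendsto (fun n => P.ι (x n)) atTop (𝓝 k) := by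
    have h1 := (hzk.sub ((P.adj.continuous.tendsto _).comp hzk)).const_smul (1 / 2 : ℂ)
    have e : (1 / 2 : ℂ) • (k - P.adj k) = k := by
      rw [hadj, sub_neg_eq_add, ← two_smul ℂ, smul_smul]; norm_num
    rw [e] at h1
    refine h1.congr fun n => ?_
    simp only [Function.comp, x, map_smul, map_sub, ← hyz n]
    congr 2
    exact adj_ι _ _
  have hres : ∀ n, ∃ v ∈ P.sub B, ‖v‖ ≤ 1 ∧ v * (1 + x n) = 1 ∧ (1 + x n) * v = 1 := by
    intro n
    obtain ⟨v, h1, h2, h3⟩ := exists_resolvent (x := (⟨x n, hxB n⟩ : P.sub B))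
      (Subtype.ext (hxs n))
    exact ⟨v, v.2, h1, congrArg Subtype.val h2, congrArg Subtype.val h3⟩
  choose v hvB hv1 hvl hvr using hres
  -- the resolvent identity shows that the resolvents are Cauchy
  have hcauchy : CauchySeq fun n => P.ι (v n) := by
    rw [Metric.cauchySeq_iff']
    intro ε hε
    obtain ⟨N, hN⟩ := Metric.cauchySeq_iff'.1 hxk.cauchySeq ε hε
    refine ⟨N, fun n hn => lt_of_le_of_lt ?_ (hN n hn)⟩
    rw [dist_eq_norm, dist_eq_norm, ← map_sub, ← map_sub]
    have e : v n - v N = v n * (x N - x n) * v N := by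
      calc v n - v N = v n * ((1 + x N) * v N) - (v n * (1 + x n)) * v N := by
            rw [hvl, hvr, mul_one, one_mul]
        _ = _ := by noncomm_ring
    rw [e, ← rightMul_ι, ← leftMul_ι]
    refine (P.norm_rightMul_apply_le _ _).trans ?_
    refine (mul_le_mul (hv1 N) (norm_leftMul_apply_le _ _) (norm_nonneg _) zero_le_one).trans ?_
    rw [one_mul, ← neg_sub, map_neg, norm_neg]
    exact mul_le_of_le_one_left (norm_nonneg _) (hv1 n)
  obtain ⟨ζ, hζ⟩ := cauchySeq_tendsto_of_complete hcauchy
  obtain ⟨w, hwB, rfl⟩ := exists_ι_eq_of_tendsto hB hv1 hvB hζ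
  have hxk1 : Tendsto (fun n => P.ι (1 + x n)) atTop (𝓝 (P.ι 1 + k)) :=
    (hxk.const_add (P.ι 1)).congr fun n => (map_add _ _ _).symm
  have hl : P.leftMul w (P.ι 1 + k) = P.ι 1 :=
    tendsto_nhds_unique (tendsto_leftMul hv1 hζ hxk1)
      (tendsto_const_nhds.congr fun n => by rw [leftMul_ι, hvl])
  have hr : P.rightMul w (P.ι 1 + k) = P.ι 1 :=
    tendsto_nhds_unique (tendsto_rightMul hv1 hζ hxk1)
      (tendsto_const_nhds.congr fun n => by rw [rightMul_ι, hvr])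
  -- `y = (1 + k) w y` bounds `y` by `w y`
  have hlow : ∀ y ∈ P.sub B, ‖P.ι y‖ ≤ (1 + C) * ‖P.ι (w * y)‖ := by
    intro y hy
    have e : P.ι y = P.ι (w * y) + P.rightMul (w * y) k := by
      calc P.ι y = P.rightMul y (P.rightMul w (P.ι 1 + k)) := by rw [hr, rightMul_ι, one_mul]
        _ = _ := by rw [rightMul_rightMul, map_add, rightMul_ι, one_mul]
    rw [e]
    refine (norm_add_le _ _).trans ?_
    rw [add_mul, one_mul]
    gcongr
    exact hbd _ (mul_mem hwB hy)
  let w' : P.sub B := ⟨w, hwB⟩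
  have hunit : IsUnit (star w' * w') := by
    refine isUnit_of_faithful_bound
      ((P.τ : P.A →ₗ[ℂ] ℂ) ∘ₗ (P.sub B).toSubalgebra.toSubmodule.subtype)
      (fun y => ?_) (fun y hy => ?_) (IsSelfAdjoint.star_mul_self w')
      (c := ((1 + C) ^ 2)⁻¹) (by positivity) (fun y => ?_)
    · change 0 ≤ P.τ (star (y : P.A) * y)
      exact P.τ.map_nonneg (star_mul_self_nonneg _)
    · exact Subtype.ext (P.τ_faithful y hy)
    · change ((1 + C) ^ 2)⁻¹ * (P.τ (star (y : P.A) * y)).re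
        ≤ (P.τ (star (y : P.A) * (star w * w) * y)).re
      have e : star (y : P.A) * (star w * w) * y = star (w * (y : P.A)) * (w * y) := by
        rw [star_mul]; simp only [mul_assoc]
      rw [e, ← norm_ι_sq_re, ← norm_ι_sq_re, inv_mul_le_iff₀ (by positivity), ← mul_pow]
      exact pow_le_pow_left₀ (norm_nonneg _) (hlow y y.2) 2
  obtain ⟨p, hp⟩ := hunit
  let q : P.sub B := ↑p⁻¹ * star w'
  have hq : (q : P.A) * w = 1 := by
    have : q * w' = 1 := by rw [mul_assoc, ← hp, Units.inv_mul]
    exact congrArg Subtype.val this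
  refine ⟨q - 1, sub_mem q.2 (one_mem _), ?_⟩
  have h1 := congrArg (P.leftMul (q : P.A)) hl
  rw [leftMul_leftMul, hq, leftMul_ι, mul_one] at h1
  have h2 : P.leftMul 1 (P.ι 1 + k) = P.ι 1 + k := by simp [leftMul]
  rw [h2] at h1
  rw [map_sub, ← h1, add_sub_cancel_left]

end ProbSpace

open ProbSpace

/-! ### Unitary cocycles: the generator of `E₀(u)` -/

namespace WhiteNoise

variable {W : WhiteNoise H} {u : ℝ → W.A} {G : W.A}

theorem real_smul_mem {B : VonNeumannAlgebra H} {x : W.A} (hx : x ∈ W.sub B) (r : ℝ) :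
    r • x ∈ W.sub B := by
  rw [← Complex.coe_smul]
  exact (W.sub B).smul_mem hx _

theorem ι_real_smul (r : ℝ) (x : W.A) : W.ι (r • x) = r • W.ι x := by
  rw [← Complex.coe_smul, map_smul, Complex.coe_smul]

theorem exp_mem_base (hG : G ∈ W.sub W.base) : NormedSpace.exp G ∈ W.sub W.base := by
  let _ : NormedAlgebra ℚ W.A := NormedAlgebra.restrictScalars ℚ ℂ W.A
  exact NormedSpace.exp_mem (R := ℂ) (isClosed_sub (P := W.toProbSpace) W.base) hG

theorem condExp_ι_of_mem {x : W.A} (hx : x ∈ W.sub W.base) :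
    W.condExp W.base (W.ι x) = W.ι x := condExp_of_mem (ι_mem_L2sub hx)

namespace IsUnitaryCocycle

theorem zero (hu : W.IsUnitaryCocycle u) : u 0 = 1 := by
  have h := hu.cocycle 0 0 le_rfl le_rfl
  rw [add_zero, S_zero] at h
  have h1 := Unitary.star_mul_self_of_mem (hu.unitary 0 le_rfl)
  calc u 0 = star (u 0) * u 0 * u 0 := by rw [h1, one_mul]
    _ = star (u 0) * (u 0 * u 0) := mul_assoc _ _ _
    _ = 1 := by rw [← h, h1]

/-- The compression of a unitary cocycle to `A₀` is multiplicative. -/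
theorem condExp_mul (hu : W.IsUnitaryCocycle u) {e : ℝ → W.A}
    (he : ∀ t, 0 ≤ t → e t ∈ W.sub W.base ∧ W.ι (e t) = W.condExp W.base (W.ι (u t)))
    {s t : ℝ} (hs : 0 ≤ s) (ht : 0 ≤ t) : e (s + t) = e s * e t := by
  apply ι_injective (P := W.toProbSpace)
  obtain ⟨hsB, hse⟩ := he s hs
  obtain ⟨htB, hte⟩ := he t ht
  obtain ⟨hstB, hste⟩ := he (s + t) (add_nonneg hs ht)
  refine eq_of_mem_L2sub_of_inner_eq (ι_mem_L2sub hstB) (ι_mem_L2sub (mul_mem hsB htB))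
    fun a ha => ?_
  rw [hste, inner_condExp_of_mem (ι_mem_L2sub ha), hu.cocycle s t hs ht]
  calc ⟪W.ι a, W.ι (W.S t (u s) * u t)⟫_ℂ
      = ⟪W.ι (a * star (u t)), W.ι (W.S t (u s))⟫_ℂ := by
        rw [← rightMul_ι, ← rightMul_ι, inner_rightMul, star_star]
    _ = ⟪W.ι (a * star (u t)), W.condExp W.base (W.ι (W.S t (u s)))⟫_ℂ :=
        inner_past_future ht (by linarith : t ≤ s + t)
          (ι_mem_L2sub (mul_mem (base_le_sub (isInterval_Icc ht) ha)
            (star_mem (hu.adapted t ht))))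
          (ι_mem_L2sub (S_mem_filt hs (hu.adapted s hs)))
    _ = ⟪W.ι (a * star (u t)), W.ι (e s)⟫_ℂ := by rw [← S2_ι, condExp_S2, hse]
    _ = ⟪W.ι (star (e s) * a), W.ι (u t)⟫_ℂ := by
        rw [← rightMul_ι, inner_rightMul, rightMul_ι, star_star, ← leftMul_ι, ← leftMul_ι,
          inner_leftMul, star_star]
    _ = ⟪W.ι (star (e s) * a), W.ι (e t)⟫_ℂ := by
        rw [hte, inner_condExp_of_mem (ι_mem_L2sub (mul_mem (star_mem hsB) ha))]
    _ = ⟪W.ι a, W.ι (e s * e t)⟫_ℂ := by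
        rw [← leftMul_ι, inner_leftMul, star_star, leftMul_ι]

/-- A unitary cocycle is `L²`-continuous at time `0`. -/
theorem tendsto_one (hu : W.IsUnitaryCocycle u) :
    Tendsto (fun t => ‖W.ι (u t) - W.ι 1‖) (𝓝[≥] 0) (𝓝 0) := by
  have h1 : Tendsto (fun t => W.τ (u t)) (𝓝[≥] 0) (𝓝 (W.τ (u 0))) :=
    hu.continuous W.τ W.τ_normal 0 Set.self_mem_Ici
  rw [hu.zero, W.τ_one] at h1
  have h2 := (Complex.continuous_re.tendsto _).comp h1
  have h3 := (h2.const_mul 2).const_sub 2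
  have h4 : Tendsto (fun t => ‖W.ι (u t) - W.ι 1‖ ^ 2) (𝓝[≥] 0) (𝓝 0) := by
    have e : (2 : ℝ) - 2 * (1 : ℂ).re = 0 := by simp
    rw [e] at h3
    refine h3.congr' ?_
    filter_upwards [self_mem_nhdsWithin] with t ht
    rw [@norm_sub_sq ℂ, norm_ι_unitary (hu.unitary t ht), norm_ι_one, inner_re_symm,
      ← τ_eq_inner]
    simp only [Function.comp, RCLike.re_to_complex]
    ring
  have h5 := h4.sqrt
  rw [Real.sqrt_zero] at h5
  exact h5.congr fun t => Real.sqrt_sq (norm_nonneg _)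

end IsUnitaryCocycle

/-- `G ∈ A₀` is the generator of the semigroup `E₀(u)`. -/
def IsGenerator (u : ℝ → W.A) (G : W.A) : Prop :=
  G ∈ W.sub W.base ∧
    ∀ t, 0 ≤ t → W.condExp W.base (W.ι (u t)) = W.ι (NormedSpace.exp (t • G))

theorem IsUnitaryData.exists_generator (hu : W.IsUnitaryData u) : ∃ G, W.IsGenerator u G := by
  obtain ⟨e, he, hc⟩ := hu.norm_continuous
  have h0 : e 0 = 1 := by
    apply ι_injective (P := W.toProbSpace)
    rw [(he 0 le_rfl).2, hu.zero, condExp_ι_of_mem (one_mem _)]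
  obtain ⟨G, hG⟩ := exists_eq_exp_of_semigroup hc h0
    fun s t hs ht => hu.toIsUnitaryCocycle.condExp_mul he hs ht
  refine ⟨G, ?_, fun t ht => by rw [← hG t ht, (he t ht).2]⟩
  have h1 := tendsto_nat_smul_exp_sub_one G 1
  rw [one_smul] at h1
  refine (isClosed_sub (P := W.toProbSpace) W.base).mem_of_tendsto h1
    (Eventually.of_forall fun N => real_smul_mem (sub_mem ?_ (one_mem _)) _)
  rw [← hG _ (by positivity)]
  exact (he _ (by positivity)).1

theorem star_smul_of_skew (hG : star G = -G) (t : ℝ) : star (t • G) = -(t • G) := by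
  rw [star_smul, hG, smul_neg]; simp

theorem exp_mem_unitary (hG : star G = -G) (t : ℝ) :
    NormedSpace.exp (t • G) ∈ unitary W.A := by
  let _ : NormedAlgebra ℚ W.A := NormedAlgebra.restrictScalars ℚ ℂ W.A
  exact NormedSpace.exp_mem_unitary_of_mem_skewAdjoint
    (skewAdjoint.mem_iff.2 (star_smul_of_skew hG t))

/-- If the compression `E₀(u_t)` is unitary, then `u_t` has no component orthogonal to `A₀`,
since both have `L²`-norm one. -/
theorem IsGenerator.eq_exp (hu : W.IsUnitaryCocycle u) (hG : W.IsGenerator u G)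
    (hs : star G = -G) {t : ℝ} (ht : 0 ≤ t) : u t = NormedSpace.exp (t • G) := by
  apply ι_injective (P := W.toProbSpace)
  set e : W.A := NormedSpace.exp (t • G)
  have he : W.ι e ∈ W.L2sub W.base := ι_mem_L2sub (exp_mem_base (real_smul_mem hG.1 t))
  have h1 : ‖W.ι e‖ = 1 := norm_ι_unitary (exp_mem_unitary hs t)
  have h2 : ⟪W.ι e, W.ι (u t)⟫_ℂ = 1 := by
    rw [← inner_condExp_of_mem he, hG.2 t ht, inner_self_eq_norm_sq_to_K, h1]
    simp
  have h3 : ‖W.ι (u t) - W.ι e‖ ^ 2 = 0 := by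
    rw [@norm_sub_sq ℂ, inner_re_symm, h2, h1, norm_ι_unitary (hu.unitary t ht)]
    norm_num
  exact sub_eq_zero.1 (norm_eq_zero.1 (pow_eq_zero_iff two_ne_zero |>.1 h3))

/-- For differentiable `u` the generator is skew adjoint: by unitarity
`E₀(u_t + u_t^* - 2) = -E₀ |u_t - 1|²`, which is of second order in `t`. -/
theorem IsGenerator.star_eq_neg (hu : W.IsUnitaryCocycle u) (hG : W.IsGenerator u G)
    (hd : W.WeaklyDifferentiableAtZero fun t => W.ι (u t)) : star G = -G := by
  obtain ⟨C, hC⟩ := hd.exists_bound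
  rw [hu.zero] at hC
  set Z : W.A := G + star G with hZ
  have hZs : star Z = Z := by rw [hZ, star_add, star_star, add_comm]
  have hZB : Z ∈ W.sub W.base := add_mem hG.1 (star_mem hG.1)
  let e : ℕ → W.A := fun N => NormedSpace.exp ((1 / (N : ℝ)) • G) - 1
  have h1 : Tendsto (fun N : ℕ => (N : ℝ) • e N) atTop (𝓝 G) := by
    have h := tendsto_nat_smul_exp_sub_one G 1
    rwa [one_smul] at h
  have h2 : Tendsto (fun N : ℕ => ⟪W.ι Z, W.ι ((N : ℝ) • e N + star ((N : ℝ) • e N))⟫_ℂ) atTop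
      (𝓝 ⟪W.ι Z, W.ι Z⟫_ℂ) :=
    tendsto_const_nhds.inner
      ((continuous_ι.tendsto _).comp (h1.add ((continuous_star.tendsto _).comp h1)))
  have h3 : ∀ n : ℕ, ‖⟪W.ι Z, W.ι (((n + 1 : ℕ) : ℝ) • e (n + 1)
      + star (((n + 1 : ℕ) : ℝ) • e (n + 1)))⟫_ℂ‖ ≤ ‖Z‖ * C ^ 2 * (1 / ((n + 1 : ℕ) : ℝ)) := by
    intro n
    set N : ℝ := ((n + 1 : ℕ) : ℝ) with hN
    have hNpos : 0 < N := by positivity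
    set v : W.A := u (1 / N) with hv
    have hvu := Unitary.star_mul_self_of_mem (hu.unitary (1 / N) (by positivity))
    have hev : ⟪W.ι Z, W.ι (e (n + 1))⟫_ℂ = ⟪W.ι Z, W.ι (v - 1)⟫_ℂ := by
      have : W.condExp W.base (W.ι (v - 1)) = W.ι (e (n + 1)) := by
        rw [map_sub, map_sub, hv, hG.2 _ (by positivity), condExp_ι_of_mem (one_mem _), ← map_sub]
      rw [← inner_condExp_of_mem (ι_mem_L2sub hZB) (W.ι (v - 1)), this]
    have hstar : ∀ y : W.A, ⟪W.ι Z, W.ι (star y)⟫_ℂ = star ⟪W.ι Z, W.ι y⟫_ℂ := fun y => by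
      rw [inner_ι, inner_ι, ← τ_star, star_mul, star_star, W.τ_mul_comm, hZs]
    have hsq : (v - 1) + star (v - 1) = -(star (v - 1) * (v - 1)) := by
      simp only [star_sub, star_one, sub_mul, mul_sub, one_mul, mul_one]
      rw [hvu]
      abel
    have hmain : ⟪W.ι Z, W.ι (N • e (n + 1) + star (N • e (n + 1)))⟫_ℂ
        = -(N * ⟪W.rightMul Z (W.ι (v - 1)), W.ι (v - 1)⟫_ℂ) := by
      have : N • e (n + 1) + star (N • e (n + 1)) = (N : ℂ) • (e (n + 1) + star (e (n + 1))) := by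
        rw [star_smul, Complex.coe_smul, smul_add]; simp
      rw [this, map_smul, inner_smul_right, map_add W.ι (e (n + 1)), inner_add_right, hstar,
        hev, ← hstar, ← inner_add_right, ← map_add, hsq, map_neg, inner_neg_right, mul_neg]
      congr 2
      rw [rightMul_ι, inner_ι, inner_ι, star_mul, mul_assoc]
    have hvC : ‖W.ι (v - 1)‖ ≤ C / N := by
      have := hC n
      rw [← map_sub] at this
      simpa [hv, hN] using this
    rw [hmain, norm_neg, norm_mul, Complex.norm_real, Real.norm_of_nonneg hNpos.le]
    calc N * ‖⟪W.rightMul Z (W.ι (v - 1)), W.ι (v - 1)⟫_ℂ‖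
        ≤ N * (‖Z‖ * ‖W.ι (v - 1)‖ * ‖W.ι (v - 1)‖) := by
          gcongr
          refine (norm_inner_le_norm _ _).trans ?_
          gcongr
          exact W.norm_rightMul_apply_le _ _
      _ = N * (‖Z‖ * ‖W.ι (v - 1)‖ ^ 2) := by ring
      _ ≤ N * (‖Z‖ * (C / N) ^ 2) := by gcongr
      _ = _ := by field_simp
  have h4 : Tendsto (fun n : ℕ => ‖Z‖ * C ^ 2 * (1 / ((n + 1 : ℕ) : ℝ))) atTop
      (𝓝 (‖Z‖ * C ^ 2 * 0)) :=
    ((tendsto_const_div_atTop_nhds_zero_nat 1).comp (tendsto_add_atTop_nat 1)).const_mul _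
  rw [mul_zero] at h4
  have h5 := tendsto_nhds_unique (h2.comp (tendsto_add_atTop_nat 1)) (squeeze_zero_norm h3 h4)
  have h6 : Z = 0 := ι_injective (P := W.toProbSpace) (by rw [inner_self_eq_zero.1 h5, map_zero])
  rw [hZ, add_comm] at h6
  exact eq_neg_of_add_eq_zero_left h6

/-- The stochastic derivative has the generator as its drift. -/
theorem IsGenerator.drift_eq_of_derivative {b : ℝ → W.L2} (hG : W.IsGenerator u G)
    (h : W.IsStochasticDerivative u b) : drift b = W.ι G := by
  have h1 := ((W.condExp W.base).continuous.tendsto _).comp (h 1 zero_le_one)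
  have h2 := tendsto_nat_smul_exp_sub_one G 1
  rw [one_smul] at h2
  refine tendsto_nhds_unique h1 (((continuous_ι.tendsto _).comp h2).congr fun N => ?_)
  simp only [Function.comp, map_sum, condExp_S2]
  rw [Finset.sum_const, Finset.card_range, map_sub, map_sub, hG.2 _ (by positivity),
    condExp_ι_of_mem (one_mem _), ← map_sub, ι_real_smul, Nat.cast_smul_eq_nsmul]

/-! ### Subdivisions and simple processes -/

namespace IsSubdivision

variable {t : ℝ} {n : ℕ} {p : ℕ → ℝ}

theorem mono (hp : IsSubdivision t n p) {i j : ℕ} (hij : i ≤ j) (hj : j ≤ n) : p i ≤ p j := by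
  induction j, hij using Nat.le_induction with
  | base => exact le_rfl
  | succ j _ ih => exact (ih (by omega)).trans (hp.lt j (by omega)).le

theorem nonneg (hp : IsSubdivision t n p) {j : ℕ} (hj : j ≤ n) : 0 ≤ p j :=
  hp.zero ▸ hp.mono (Nat.zero_le j) hj

theorem sum_sub (hp : IsSubdivision t n p) : ∑ j ∈ Finset.range n, (p (j + 1) - p j) = t := by
  rw [Finset.sum_range_sub, hp.zero, hp.last, sub_zero]

theorem exists_mem_Ico (hp : IsSubdivision t n p) {s : ℝ} (hs : s ∈ Set.Ico 0 t) :
    ∃ j < n, s ∈ Set.Ico (p j) (p (j + 1)) := by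
  have key : ∀ m ≤ n, s < p m → ∃ j < n, s ∈ Set.Ico (p j) (p (j + 1)) := by
    intro m
    induction m with
    | zero => intro _ h; rw [hp.zero] at h; exact absurd hs.1 (not_le.2 h)
    | succ m ih =>
      intro hm h
      rcases lt_or_ge s (p m) with h' | h'
      · exact ih (by omega) h'
      · exact ⟨m, by omega, h', h⟩
  exact key n le_rfl (by rw [hp.last]; exact hs.2)

theorem eq_of_mem_Ico (hp : IsSubdivision t n p) {s : ℝ} {i j : ℕ} (hi : i < n) (hj : j < n)
    (hsi : s ∈ Set.Ico (p i) (p (i + 1))) (hsj : s ∈ Set.Ico (p j) (p (j + 1))) : i = j := by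
  rcases lt_trichotomy i j with h | h | h
  · have := hp.mono (i := i + 1) (j := j) h hj.le
    linarith [hsi.2, hsj.1]
  · exact h
  · have := hp.mono (i := j + 1) (j := i) h hi.le
    linarith [hsj.2, hsi.1]

theorem sum_lintegral (hp : IsSubdivision t n p) (f : ℝ → ENNReal) :
    ∑ j ∈ Finset.range n, ∫⁻ s in Set.Ico (p j) (p (j + 1)), f s = ∫⁻ s in Set.Ico 0 t, f s := by
  have key : ∀ m ≤ n, ∑ j ∈ Finset.range m, ∫⁻ s in Set.Ico (p j) (p (j + 1)), f s
      = ∫⁻ s in Set.Ico 0 (p m), f s := by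
    intro m
    induction m with
    | zero => intro _; simp [hp.zero]
    | succ m ih =>
      intro hm
      rw [Finset.sum_range_succ, ih (by omega), ← lintegral_union measurableSet_Ico
        Set.Ico_disjoint_Ico_same, Set.Ico_union_Ico_eq_Ico (hp.nonneg (by omega))
        (hp.lt m (by omega)).le]
  rw [key n le_rfl, hp.last]

end IsSubdivision

variable {W : WhiteNoise H} {u : ℝ → W.A} {b : ℝ → W.L2} {G : W.A} {t : ℝ}

theorem StepIntegrand.toFun_eq (y : W.StepIntegrand t) {j : ℕ} (hj : j < y.n) {s : ℝ}
    (hs : s ∈ Set.Ico (y.pt j) (y.pt (j + 1))) : y.toFun s = W.ι (y.val j) := by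
  rw [StepIntegrand.toFun, Finset.sum_eq_single j]
  · exact Set.indicator_of_mem hs _
  · intro i hi hij
    refine Set.indicator_of_notMem (fun h => hij ?_) _
    exact y.subdivision.eq_of_mem_Ico (Finset.mem_range.1 hi) hj h hs
  · intro h
    exact absurd (Finset.mem_range.2 hj) h

/-! ### The drift of an Itô integral -/

/-- Tested against `A₀`, only the drift of `b` contributes to the Itô integral, by
independence of the increments from the past. -/
theorem StepIntegrand.inner_integral (hb : W.IsAdditiveCocycle b) (y : W.StepIntegrand t)
    {a : W.A} (ha : a ∈ W.sub W.base) :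
    ⟪W.ι a, y.integral b⟫_ℂ = ∑ j ∈ Finset.range y.n,
      ((y.pt (j + 1) - y.pt j : ℝ) : ℂ) * ⟪W.ι (a * star (y.val j)), drift b⟫_ℂ := by
  rw [StepIntegrand.integral, inner_sum]
  refine Finset.sum_congr rfl fun j hj => ?_
  have hj' := Finset.mem_range.1 hj
  have h0 := y.subdivision.nonneg hj'.le
  have h1 := (y.subdivision.lt j hj').le
  rw [← star_star (y.val j), ← inner_rightMul, rightMul_ι, star_star,
    inner_past_future h0 h1 (ι_mem_L2sub (mul_mem (base_le_sub (isInterval_Icc h0) ha)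
      (star_mem (y.adapted j hj')))) (hb.sub_mem h0 h1), hb.condExp_sub h0 h1,
    ← Complex.coe_smul, inner_smul_right]

/-- Tested against `A₀`, the error of replacing a simple integrand by the constant `1` is controlled
by its distance from `1` in `L¹([0, t])`. -/
theorem StepIntegrand.norm_inner_integral_sub_le (hb : W.IsAdditiveCocycle b)
    (y : W.StepIntegrand t) {a : W.A} (ha : a ∈ W.sub W.base) :
    ‖⟪W.ι a, y.integral b⟫_ℂ - t * ⟪W.ι a, drift b⟫_ℂ‖ ≤ ‖a‖ * ‖drift b‖ *
      ∑ j ∈ Finset.range y.n, (y.pt (j + 1) - y.pt j) * ‖W.ι (y.val j) - W.ι 1‖ := by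
  have e : (t : ℂ) * ⟪W.ι a, drift b⟫_ℂ = ∑ j ∈ Finset.range y.n,
      ((y.pt (j + 1) - y.pt j : ℝ) : ℂ) * ⟪W.ι a, drift b⟫_ℂ := by
    rw [← Finset.sum_mul, ← Complex.ofReal_sum, y.subdivision.sum_sub]
  rw [y.inner_integral hb ha, e, ← Finset.sum_sub_distrib, Finset.mul_sum]
  refine norm_sum_le_of_le _ fun j hj => ?_
  have h1 : 0 ≤ y.pt (j + 1) - y.pt j :=
    sub_nonneg.2 (y.subdivision.lt j (Finset.mem_range.1 hj)).le
  have e2 : W.ι (a * star (y.val j)) - W.ι a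
      = W.leftMul a (W.adj (W.ι (y.val j) - W.ι 1)) := by
    rw [← map_sub W.ι (y.val j) 1, adj_ι, leftMul_ι, ← map_sub]
    congr 1
    rw [star_sub, star_one, mul_sub, mul_one]
  rw [← mul_sub, ← inner_sub_left, e2, norm_mul, Complex.norm_real, Real.norm_of_nonneg h1]
  calc (y.pt (j + 1) - y.pt j) *
        ‖⟪W.leftMul a (W.adj (W.ι (y.val j) - W.ι 1)), drift b⟫_ℂ‖
      ≤ (y.pt (j + 1) - y.pt j) * (‖a‖ * ‖W.ι (y.val j) - W.ι 1‖ * ‖drift b‖) := by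
        gcongr
        refine (norm_inner_le_norm _ _).trans ?_
        gcongr
        refine (norm_leftMul_apply_le _ _).trans ?_
        rw [norm_adj]
    _ = _ := by ring

theorem StepIntegrand.ofReal_sum_eq_lintegral (y : W.StepIntegrand t) (ζ : W.L2) :
    ENNReal.ofReal (∑ j ∈ Finset.range y.n, (y.pt (j + 1) - y.pt j) * ‖W.ι (y.val j) - ζ‖)
      = ∫⁻ s in Set.Ico 0 t, ‖y.toFun s - ζ‖ₑ := by
  have hpos : ∀ j ∈ Finset.range y.n, 0 ≤ y.pt (j + 1) - y.pt j := fun j hj =>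
    sub_nonneg.2 (y.subdivision.lt j (Finset.mem_range.1 hj)).le
  rw [← y.subdivision.sum_lintegral, ENNReal.ofReal_sum_of_nonneg fun j hj =>
    mul_nonneg (hpos j hj) (norm_nonneg _)]
  refine Finset.sum_congr rfl fun j hj => ?_
  rw [setLIntegral_congr_fun measurableSet_Ico fun s hs => by
    rw [y.toFun_eq (Finset.mem_range.1 hj) hs]]
  rw [setLIntegral_const, Real.volume_Ico, ENNReal.ofReal_mul (hpos j hj), ofReal_norm,
    mul_comm]

theorem enorm_le_of_near {x y z : W.L2} {δ : ℝ} (hδ : 0 < δ) (h : ‖y - z‖ ≤ δ) :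
    ‖x - z‖ₑ ≤ ENNReal.ofReal (2 * δ) + ENNReal.ofReal (1 / δ) * ‖x - y‖ₑ ^ 2 := by
  rw [← ofReal_norm, ← ofReal_norm, ← ENNReal.ofReal_pow (norm_nonneg _),
    ← ENNReal.ofReal_mul (by positivity), ← ENNReal.ofReal_add (by positivity) (by positivity)]
  refine ENNReal.ofReal_le_ofReal ?_
  have h1 : ‖x - z‖ ≤ ‖x - y‖ + ‖y - z‖ := norm_sub_le_norm_sub_add_norm_sub _ _ _
  -- `r ≤ δ + r² / δ`
  have h2 : ‖x - y‖ ≤ δ + 1 / δ * ‖x - y‖ ^ 2 := by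
    have : 1 / δ * ‖x - y‖ ^ 2 * δ = ‖x - y‖ ^ 2 := by field_simp
    by_contra! hlt
    nlinarith [mul_lt_mul_of_pos_right hlt hδ, sq_nonneg (‖x - y‖ - δ), norm_nonneg (x - y)]
  linarith

/-- While `y` stays `δ`-close to `1`, the Itô integral `∫₀ᵗ db_s y_s`, tested against `A₀`, is
`2 δ t`-close to `t` times the drift of `b`. -/
theorem IsItoIntegral.norm_inner_sub_le (hb : W.IsAdditiveCocycle b) {y : ℝ → W.L2} {z : W.L2}
    (h : W.IsItoIntegral b y t z) (ht : 0 ≤ t) {δ : ℝ} (hδ : 0 < δ)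
    (hy : ∀ s ∈ Set.Ico 0 t, ‖y s - W.ι 1‖ ≤ δ) {a : W.A} (ha : a ∈ W.sub W.base) :
    ‖⟪W.ι a, z⟫_ℂ - t * ⟪W.ι a, drift b⟫_ℂ‖ ≤ ‖a‖ * ‖drift b‖ * (2 * δ * t) := by
  obtain ⟨x, hx, hz⟩ := h
  have h1 : ∀ m, ENNReal.ofReal ‖⟪W.ι a, (x m).integral b⟫_ℂ - t * ⟪W.ι a, drift b⟫_ℂ‖ ≤
      ENNReal.ofReal (‖a‖ * ‖drift b‖) * (ENNReal.ofReal (2 * δ * t) +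
        ENNReal.ofReal (1 / δ) * ∫⁻ s in Set.Ico 0 t, ‖(x m).toFun s - y s‖ₑ ^ 2) := by
    intro m
    refine (ENNReal.ofReal_le_ofReal ((x m).norm_inner_integral_sub_le hb ha)).trans ?_
    rw [ENNReal.ofReal_mul (by positivity), (x m).ofReal_sum_eq_lintegral]
    gcongr
    calc ∫⁻ s in Set.Ico 0 t, ‖(x m).toFun s - W.ι 1‖ₑ
        ≤ ∫⁻ s in Set.Ico 0 t, (ENNReal.ofReal (2 * δ) +
            ENNReal.ofReal (1 / δ) * ‖(x m).toFun s - y s‖ₑ ^ 2) :=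
          setLIntegral_mono' measurableSet_Ico fun s hs => enorm_le_of_near hδ (hy s hs)
      _ = _ := by
          rw [lintegral_add_left measurable_const, lintegral_const_mul' _ _ ENNReal.ofReal_ne_top,
            setLIntegral_const, Real.volume_Ico, sub_zero, ← ENNReal.ofReal_mul (by positivity)]
  have h2 : Tendsto (fun m => ENNReal.ofReal
      ‖⟪W.ι a, (x m).integral b⟫_ℂ - t * ⟪W.ι a, drift b⟫_ℂ‖) atTop
      (𝓝 (ENNReal.ofReal ‖⟪W.ι a, z⟫_ℂ - t * ⟪W.ι a, drift b⟫_ℂ‖)) :=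
    (ENNReal.continuous_ofReal.tendsto _).comp
      (((tendsto_const_nhds.inner hz).sub_const _).norm)
  have h3 : Tendsto (fun m => ENNReal.ofReal (‖a‖ * ‖drift b‖) * (ENNReal.ofReal (2 * δ * t) +
        ENNReal.ofReal (1 / δ) * ∫⁻ s in Set.Ico 0 t, ‖(x m).toFun s - y s‖ₑ ^ 2)) atTop
      (𝓝 (ENNReal.ofReal (‖a‖ * ‖drift b‖) * (ENNReal.ofReal (2 * δ * t) +
        ENNReal.ofReal (1 / δ) * 0))) :=
    ENNReal.Tendsto.const_mul (tendsto_const_nhds.add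
      (ENNReal.Tendsto.const_mul hx (Or.inr ENNReal.ofReal_ne_top)))
      (Or.inr ENNReal.ofReal_ne_top)
  have h4 := le_of_tendsto_of_tendsto' h2 h3 h1
  rw [mul_zero, add_zero, ← ENNReal.ofReal_mul (by positivity)] at h4
  exact (ENNReal.ofReal_le_ofReal_iff (by positivity)).1 h4

/-- The driving process of the stochastic differential equation has the generator as its drift:
apply `E₀` to the equation and differentiate at `0`. -/
theorem IsGenerator.drift_eq_of_solvesSDE (hu : W.IsUnitaryCocycle u) (hG : W.IsGenerator u G)
    (hb : W.IsAdditiveCocycle b) (h : W.SolvesSDE b u) : drift b = W.ι G := by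
  refine eq_of_mem_L2sub_of_inner_eq (drift_mem b) (ι_mem_L2sub hG.1) fun a ha => ?_
  have key : ∀ δ > 0, ‖⟪W.ι a, W.ι G⟫_ℂ - ⟪W.ι a, drift b⟫_ℂ‖ ≤ ‖a‖ * ‖drift b‖ * (2 * δ) := by
    intro δ hδ
    have h1 : ∀ᶠ s in 𝓝[≥] (0 : ℝ), ‖W.ι (u s) - W.ι 1‖ ≤ δ :=
      hu.tendsto_one.eventually_le_const hδ
    obtain ⟨T, hT, hTs⟩ := mem_nhdsGE_iff_exists_Ico_subset.1 h1
    have h2 := tendsto_nat_smul_exp_sub_one G 1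
    rw [one_smul] at h2
    have h3 : Tendsto (fun N : ℕ => ‖⟪W.ι a, W.ι ((N : ℝ) •
        (NormedSpace.exp ((1 / (N : ℝ)) • G) - 1))⟫_ℂ - ⟪W.ι a, drift b⟫_ℂ‖) atTop
        (𝓝 ‖⟪W.ι a, W.ι G⟫_ℂ - ⟪W.ι a, drift b⟫_ℂ‖) :=
      ((tendsto_const_nhds.inner ((continuous_ι.tendsto _).comp h2)).sub_const _).norm
    refine le_of_tendsto h3 ?_
    filter_upwards [eventually_gt_atTop 0,
      (tendsto_const_div_atTop_nhds_zero_nat (1 : ℝ)).eventually_lt_const hT] with N hN0 hNT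
    have hN : (0 : ℝ) < N := by exact_mod_cast hN0
    have h4 := (h (1 / N) (by positivity)).norm_inner_sub_le hb (by positivity) hδ
      (fun s hs => hTs ⟨hs.1, hs.2.trans hNT⟩) ha
    have h5 : ⟪W.ι a, W.ι (u (1 / N) - 1)⟫_ℂ
        = ⟪W.ι a, W.ι (NormedSpace.exp ((1 / (N : ℝ)) • G) - 1)⟫_ℂ := by
      rw [← inner_condExp_of_mem (ι_mem_L2sub ha), map_sub, map_sub, hG.2 _ (by positivity),
        condExp_ι_of_mem (one_mem _), ← map_sub]
    rw [h5] at h4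
    have h6 := mul_le_mul_of_nonneg_left h4 hN.le
    have hNc : (N : ℂ) ≠ 0 := by exact_mod_cast hN.ne'
    have e : ⟪W.ι a, W.ι ((N : ℝ) • (NormedSpace.exp ((1 / (N : ℝ)) • G) - 1))⟫_ℂ
        - ⟪W.ι a, drift b⟫_ℂ
        = N * (⟪W.ι a, W.ι (NormedSpace.exp ((1 / (N : ℝ)) • G) - 1)⟫_ℂ
          - ((1 / N : ℝ) : ℂ) * ⟪W.ι a, drift b⟫_ℂ) := by
      rw [← Complex.coe_smul, map_smul, inner_smul_right, mul_sub]
      push_cast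
      field_simp
    rw [e, norm_mul, Complex.norm_natCast]
    refine h6.trans (le_of_eq ?_)
    field_simp
  have hlim : Tendsto (fun n : ℕ => ‖a‖ * ‖drift b‖ * (2 * (1 / ((n : ℝ) + 1)))) atTop
      (𝓝 (‖a‖ * ‖drift b‖ * (2 * 0))) :=
    (tendsto_one_div_add_atTop_nhds_zero_nat.const_mul 2).const_mul _
  rw [mul_zero, mul_zero] at hlim
  have h0 := ge_of_tendsto' hlim fun n => key _ (Nat.one_div_pos_of_nat (α := ℝ))
  exact (sub_eq_zero.1 (norm_le_zero_iff.1 h0)).symm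

/-! ### The cocycles generated by a skew adjoint element of `A₀` -/

variable {W : WhiteNoise H} {u : ℝ → W.A} {b : ℝ → W.L2} {G : W.A} {t : ℝ}

theorem continuous_exp_smul (G : W.A) : Continuous fun t : ℝ => NormedSpace.exp (t • G) :=
  continuous_iff_continuousAt.2 fun t => (hasDerivAt_exp_smul_const G t).continuousAt

theorem exp_add_smul (G : W.A) (s t : ℝ) :
    NormedSpace.exp ((s + t) • G) = NormedSpace.exp (s • G) * NormedSpace.exp (t • G) := by
  let _ : NormedAlgebra ℚ W.A := NormedAlgebra.restrictScalars ℚ ℂ W.A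
  rw [add_smul, NormedSpace.exp_add_of_commute]
  exact ((Commute.refl G).smul_left s).smul_right t

theorem norm_exp_smul_le (hs : star G = -G) (t : ℝ) : ‖NormedSpace.exp (t • G)‖ ≤ 1 := by
  have : Nontrivial W.A := ⟨⟨1, 0, fun h => by
    have h1 := W.τ_one
    rw [h, map_zero] at h1
    exact zero_ne_one h1⟩⟩
  exact (CStarRing.norm_of_mem_unitary (exp_mem_unitary hs t)).le

theorem isUnitaryData_exp (hG : G ∈ W.sub W.base) (hs : star G = -G) :
    W.IsUnitaryData fun t => NormedSpace.exp (t • G) where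
  unitary t _ := exp_mem_unitary hs t
  continuous := weakStarContinuousOn_of_bounded (continuous_exp_smul G).continuousOn
    ⟨1, norm_exp_smul_le hs⟩
  adapted t ht := base_le_sub (isInterval_Icc ht) (exp_mem_base (real_smul_mem hG t))
  cocycle s t _ _ := by
    rw [S_of_mem_base (exp_mem_base (real_smul_mem hG s)), exp_add_smul]
  norm_continuous := ⟨fun t => NormedSpace.exp (t • G), fun t _ =>
    ⟨exp_mem_base (real_smul_mem hG t),
      (condExp_ι_of_mem (exp_mem_base (real_smul_mem hG t))).symm⟩,
    (continuous_exp_smul G).continuousOn⟩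

/-- The family `t G` has vanishing quadratic variation. -/
theorem isQuadVar_smul (ζ : W.L2) (ht : 0 ≤ t) : W.IsQuadVar (fun t => t • ζ) t 0 := by
  intro ε hε
  have hM : 0 < t * ‖ζ‖ ^ 2 + 1 := by positivity
  refine ⟨ε / (t * ‖ζ‖ ^ 2 + 1), by positivity, fun n p hp hmesh => ?_⟩
  set δ := ε / (t * ‖ζ‖ ^ 2 + 1) with hδ
  have hδ0 : 0 < δ := by positivity
  have h1 : ∀ j ∈ Finset.range n, ‖W.starMul (p (j + 1) • ζ - p j • ζ) (p (j + 1) • ζ - p j • ζ)‖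
      ≤ (p (j + 1) - p j) * (δ * ‖ζ‖ ^ 2) := by
    intro j hj
    have hj' := Finset.mem_range.1 hj
    have h0 : 0 ≤ p (j + 1) - p j := sub_nonneg.2 (hp.lt j hj').le
    refine (norm_starMul_le _ _).trans ?_
    rw [← sub_smul, norm_smul, Real.norm_of_nonneg h0]
    calc (p (j + 1) - p j) * ‖ζ‖ * ((p (j + 1) - p j) * ‖ζ‖)
        = (p (j + 1) - p j) * ((p (j + 1) - p j) * ‖ζ‖ ^ 2) := by ring
      _ ≤ _ := by gcongr; exact (hmesh j hj').le
  rw [sub_zero]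
  refine (norm_sum_le_of_le _ h1).trans_lt ?_
  rw [← Finset.sum_mul, hp.sum_sub]
  have h2 : δ * (t * ‖ζ‖ ^ 2 + 1) = ε := div_mul_cancel₀ _ hM.ne'
  calc t * (δ * ‖ζ‖ ^ 2) = δ * (t * ‖ζ‖ ^ 2) := by ring
    _ < δ * (t * ‖ζ‖ ^ 2 + 1) := by gcongr; linarith
    _ = ε := h2

theorem isAdditiveData_smul (hG : G ∈ W.sub W.base) (hs : star G = -G) :
    W.IsAdditiveData fun t => t • W.ι G where
  continuous := by fun_prop
  adapted t ht := Submodule.smul_of_tower_mem _ t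
    (L2sub_base_le (isInterval_Icc ht) (ι_mem_L2sub hG))
  cocycle s t _ _ := by
    rw [S2_of_mem_base (Submodule.smul_of_tower_mem _ s (ι_mem_L2sub hG)), add_smul]
  covariance t _ := by
    have hx : t • G ∈ W.sub W.base := real_smul_mem hG t
    refine ⟨star (t • G) * (t • G) + star (star (t • G)) * star (t • G),
      add_mem (mul_mem (star_mem hx) hx) (mul_mem (star_mem (star_mem hx)) (star_mem hx)),
      fun y _ => ?_⟩
    rw [add_apply, ← ι_real_smul, adj_ι, starMul_ι, starMul_ι, ← map_add, ← add_mul]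
  structure_equation t ht := by
    refine ⟨0, isQuadVar_smul _ ht, ?_⟩
    ext a
    rw [zero_add, add_apply, toL1_apply, toL1_apply, ← inner_add_right, ← ι_real_smul, adj_ι,
      star_smul_of_skew hs, map_neg, neg_add_cancel, inner_zero_right]
    rfl

theorem isStochasticDerivative_exp (hG : G ∈ W.sub W.base)
    (hu : ∀ t, 0 ≤ t → u t = NormedSpace.exp (t • G)) (hb : ∀ t, 0 ≤ t → b t = t • W.ι G) :
    W.IsStochasticDerivative u b := by
  intro t ht
  have h := (continuous_ι.tendsto _).comp (tendsto_nat_smul_exp_sub_one G t)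
  rw [ι_real_smul, ← hb t ht] at h
  refine h.congr fun N => ?_
  have hmem : u (t / N) - 1 ∈ W.sub W.base := by
    rw [hu _ (by positivity)]
    exact sub_mem (exp_mem_base (real_smul_mem hG _)) (one_mem _)
  simp only [Function.comp, S2_of_mem_base (ι_mem_L2sub hmem)]
  rw [Finset.sum_const, Finset.card_range, ι_real_smul, Nat.cast_smul_eq_nsmul,
    hu _ (by positivity)]

/-- The process `u`, frozen on the intervals of a uniform subdivision. -/
noncomputable def frozen (hu : W.IsUnitaryCocycle u) (ht : 0 < t) (N : ℕ) : W.StepIntegrand t where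
  n := N + 1
  pt j := j * t / (N + 1 : ℕ)
  subdivision := isSubdivision_uniform ht N
  val j := u (j * t / (N + 1 : ℕ))
  adapted j _ := hu.adapted _ (by positivity)

/-- The Riemann sums for `∫₀ᵗ G exp (s G) ds` are geometric sums. -/
theorem tendsto_frozen_integral (hu : W.IsUnitaryCocycle u) (hs : star G = -G)
    (hue : ∀ t, 0 ≤ t → u t = NormedSpace.exp (t • G)) (hb : ∀ t, 0 ≤ t → b t = t • W.ι G)
    (ht : 0 < t) : Tendsto (fun N => (frozen hu ht N).integral b) atTop
      (𝓝 (W.ι (u t - 1))) := by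
  let _ : NormedAlgebra ℚ W.A := NormedAlgebra.restrictScalars ℚ ℂ W.A
  let N' : ℕ → ℝ := fun N => ((N + 1 : ℕ) : ℝ)
  let x : ℕ → W.A := fun N => (t / N' N) • G
  let e : ℕ → W.A := fun N => NormedSpace.exp (x N)
  have hpow : ∀ N j : ℕ, NormedSpace.exp ((j * t / N' N) • G) = e N ^ j := fun N j => by
    rw [← NormedSpace.exp_nsmul, ← Nat.cast_smul_eq_nsmul ℝ, smul_smul, mul_div_assoc]
  have hint : ∀ N, (frozen hu ht N).integral b =
      W.ι (x N * ∑ j ∈ Finset.range (N + 1), e N ^ j) := by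
    intro N
    rw [StepIntegrand.integral, Finset.mul_sum, map_sum]
    refine Finset.sum_congr rfl fun j _ => ?_
    change W.rightMul (u (j * t / (N + 1 : ℕ)))
      (b (((j + 1 : ℕ) : ℝ) * t / (N + 1 : ℕ)) - b (j * t / (N + 1 : ℕ))) = _
    rw [hue _ (by positivity), hb _ (by positivity), hb _ (by positivity), ← sub_smul,
      mesh_uniform, hpow, ← ι_real_smul, rightMul_ι]
  have hgeom : ∀ N, (e N - 1) * ∑ j ∈ Finset.range (N + 1), e N ^ j = u t - 1 := fun N => by
    have : (0 : ℝ) < N' N := by positivity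
    rw [mul_geom_sum, ← hpow, hue t ht.le]
    congr 3
    change N' N * t / N' N = t
    field_simp
  have hsum : ∀ N, ‖∑ j ∈ Finset.range (N + 1), e N ^ j‖ ≤ N' N := fun N => by
    refine (norm_sum_le_of_le _ (f := fun j => e N ^ j) (n := fun _ => 1) fun j _ => ?_).trans ?_
    · rw [← hpow]; exact norm_exp_smul_le hs _
    · simp [N']
  have h1 : Tendsto (fun N : ℕ => ‖t • G - N' N • (e N - 1)‖) atTop (𝓝 0) := by
    have h := ((tendsto_nat_smul_exp_sub_one G t).comp (tendsto_add_atTop_nat 1)).const_sub (t • G)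
    rw [sub_self] at h
    have h' := h.norm
    rw [norm_zero] at h'
    exact h'
  refine tendsto_iff_norm_sub_tendsto_zero.2
    (squeeze_zero (fun _ => norm_nonneg _) (fun N => ?_) h1)
  have hN : (0 : ℝ) < N' N := by positivity
  rw [hint, ← map_sub, ← hgeom N, ← sub_mul]
  refine (W.norm_ι_le _).trans ((norm_mul_le _ _).trans ?_)
  calc ‖x N - (e N - 1)‖ * ‖∑ j ∈ Finset.range (N + 1), e N ^ j‖
      ≤ ‖x N - (e N - 1)‖ * N' N := by gcongr; exact hsum N
    _ = ‖N' N • (x N - (e N - 1))‖ := by rw [norm_smul, Real.norm_of_nonneg hN.le, mul_comm]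
    _ = _ := by
      rw [smul_sub, smul_smul]
      congr 3
      field_simp

theorem norm_exp_sub_exp_le (hs : star G = -G) (r s : ℝ) :
    ‖NormedSpace.exp (s • G) - NormedSpace.exp (r • G)‖
      ≤ ‖NormedSpace.exp ((s - r) • G) - 1‖ := by
  have e : NormedSpace.exp (s • G) - NormedSpace.exp (r • G)
      = (NormedSpace.exp ((s - r) • G) - 1) * NormedSpace.exp (r • G) := by
    rw [sub_mul, one_mul, ← exp_add_smul, sub_add_cancel]
  rw [e]
  exact (norm_mul_le _ _).trans (mul_le_of_le_one_right (norm_nonneg _) (norm_exp_smul_le hs r))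

/-- The frozen processes approximate `u` in `L²`, by continuity of `exp (t G)` in norm, which
is uniform because `exp (t G)` is unitary. -/
theorem tendsto_lintegral_frozen (hu : W.IsUnitaryCocycle u) (hs : star G = -G)
    (hue : ∀ t, 0 ≤ t → u t = NormedSpace.exp (t • G)) (ht : 0 < t) :
    Tendsto (fun N => ∫⁻ s in Set.Ico 0 t, ‖(frozen hu ht N).toFun s - W.ι (u s)‖ₑ ^ 2)
      atTop (𝓝 0) := by
  have hlim : Tendsto (fun δ : ℝ => ENNReal.ofReal (δ ^ 2 * t)) (𝓝[>] 0) (𝓝 0) := by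
    have h : Continuous fun δ : ℝ => ENNReal.ofReal (δ ^ 2 * t) :=
      ENNReal.continuous_ofReal.comp (by fun_prop)
    have h' := (h.tendsto 0).mono_left (nhdsWithin_le_nhds (s := Set.Ioi 0))
    simpa using h'
  rw [ENNReal.tendsto_nhds_zero]
  intro ε hε
  obtain ⟨δ, hδε, hδ⟩ :=
    ((hlim.eventually (eventually_le_nhds hε)).and self_mem_nhdsWithin).exists
  have hδ : 0 < δ := hδ
  have h0 : Tendsto (fun r : ℝ => ‖NormedSpace.exp (r • G) - 1‖) (𝓝 0) (𝓝 0) := by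
    have h := (((continuous_exp_smul G).sub continuous_const).norm (E := W.A)).tendsto (0 : ℝ)
      (f := fun r : ℝ => ‖NormedSpace.exp (r • G) - 1‖)
    simpa using h
  obtain ⟨η, hη, hηδ⟩ := Metric.eventually_nhds_iff.1 (h0.eventually_lt_const hδ)
  have h1 : Tendsto (fun N : ℕ => t / (N + 1 : ℕ)) atTop (𝓝 0) :=
    (tendsto_const_div_atTop_nhds_zero_nat t).comp (tendsto_add_atTop_nat 1)
  filter_upwards [h1.eventually_lt_const hη] with N hN
  refine le_trans ?_ hδε
  calc ∫⁻ s in Set.Ico 0 t, ‖(frozen hu ht N).toFun s - W.ι (u s)‖ₑ ^ 2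
      ≤ ∫⁻ _ in Set.Ico 0 t, ENNReal.ofReal (δ ^ 2) := by
        refine setLIntegral_mono' measurableSet_Ico fun s hs' => ?_
        obtain ⟨j, hj, hjs⟩ := (frozen hu ht N).subdivision.exists_mem_Ico hs'
        rw [(frozen hu ht N).toFun_eq hj hjs, ← map_sub, ← ofReal_norm,
          ← ENNReal.ofReal_pow (norm_nonneg _)]
        refine ENNReal.ofReal_le_ofReal (pow_le_pow_left₀ (norm_nonneg _) ?_ 2)
        have hjs1 : j * t / (N + 1 : ℕ) ≤ s := hjs.1
        have hjs2 : s < ((j + 1 : ℕ) : ℝ) * t / (N + 1 : ℕ) := hjs.2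
        have hmesh := mesh_uniform t N j
        refine (W.norm_ι_le _).trans ?_
        change ‖u (j * t / (N + 1 : ℕ)) - u s‖ ≤ δ
        rw [hue _ (by positivity), hue s hs'.1]
        refine (norm_exp_sub_exp_le hs _ _).trans (hηδ ?_).le
        rw [Real.dist_eq, sub_zero, abs_sub_comm, abs_of_nonneg (by linarith)]
        linarith
    _ = ENNReal.ofReal (δ ^ 2 * t) := by
        rw [setLIntegral_const, Real.volume_Ico, sub_zero, ← ENNReal.ofReal_mul (by positivity)]

theorem solvesSDE_exp (hu : W.IsUnitaryCocycle u) (hs : star G = -G)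
    (hue : ∀ t, 0 ≤ t → u t = NormedSpace.exp (t • G)) (hb : ∀ t, 0 ≤ t → b t = t • W.ι G) :
    W.SolvesSDE b u := by
  intro t ht
  rcases ht.eq_or_lt with rfl | ht
  · -- at time `0` there is only the empty simple process
    let x : W.StepIntegrand 0 :=
      { n := 0, pt := fun _ => 0, val := fun _ => 0
        subdivision := ⟨rfl, rfl, fun j hj => absurd hj (Nat.not_lt_zero j)⟩
        adapted := fun j hj => absurd hj (Nat.not_lt_zero j) }
    refine ⟨fun _ => x, by simp, ?_⟩
    have : x.integral b = W.ι (u 0 - 1) := by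
      rw [hu.zero, sub_self, map_zero]
      exact Finset.sum_range_zero _
    exact tendsto_const_nhds.congr fun _ => this.symm
  · exact ⟨frozen hu ht, tendsto_lintegral_frozen hu hs hue ht,
      tendsto_frozen_integral hu hs hue hb ht⟩

/-! ### Boundedness of the drift -/

/-- For an additive cocycle without martingale part, the bounded covariance makes the drift a
bounded element of `A₀`. -/
theorem IsAdditiveData.exists_drift_eq (hb : W.IsAdditiveData b) (h : b 1 = drift b) :
    ∃ G ∈ W.sub W.base, star G = -G ∧ W.ι G = drift b := by
  have hadj := hb.adj_drift h
  obtain ⟨K, -, hK⟩ := hb.covariance 1 zero_le_one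
  obtain ⟨G, hG, hGk⟩ := exists_ι_eq_of_bounded W.base_le (drift_mem b) hadj
    (Real.sqrt_nonneg ‖K‖) (fun y hy => by
      rw [← Real.sqrt_sq (norm_nonneg (W.rightMul y (drift b))),
        ← Real.sqrt_sq (norm_nonneg (W.ι y)), ← Real.sqrt_mul (norm_nonneg K)]
      refine Real.sqrt_le_sqrt ?_
      have h1 := hK (y * star y) (mul_mem hy (star_mem hy))
      rw [h, hadj, add_apply, starMul_apply, starMul_apply, map_neg, inner_neg_neg,
        ← rightMul_rightMul, ← inner_rightMul, inner_self_eq_norm_sq_to_K, ← mul_assoc,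
        W.τ_mul_comm, ← inner_ι, ← leftMul_ι] at h1
      have h2 := congrArg norm h1
      have h3 : ‖⟪W.ι y, W.leftMul K (W.ι y)⟫_ℂ‖ ≤ ‖W.ι y‖ * (‖K‖ * ‖W.ι y‖) :=
        (norm_inner_le_norm _ _).trans (by gcongr; exact norm_leftMul_apply_le _ _)
      have h4 : ∀ r : ℝ, ‖((r : ℂ) ^ 2 + (r : ℂ) ^ 2)‖ = 2 * r ^ 2 := fun r => by
        rw [← two_mul, norm_mul, norm_pow, Complex.norm_real]
        simp
      have h5 : 2 * ‖W.rightMul y (drift b)‖ ^ 2 = ‖⟪W.ι y, W.leftMul K (W.ι y)⟫_ℂ‖ :=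
        (h4 _).symm.trans h2
      nlinarith [sq_nonneg ‖W.rightMul y (drift b)‖])
  refine ⟨G, hG, ?_, hGk⟩
  apply ι_injective (P := W.toProbSpace)
  rw [← adj_ι, hGk, hadj, map_neg, hGk]

/-- A skew adjoint `G ∈ A₀` written as `i h`. -/
theorem exists_isSelfAdjoint_smul (hG : G ∈ W.sub W.base) (hs : star G = -G) :
    ∃ h : W.A, h.op ∈ W.base ∧ IsSelfAdjoint h ∧ ∀ t : ℝ, (Complex.I * (t : ℂ)) • h = t • G := by
  refine ⟨(-Complex.I) • G, (W.sub W.base).smul_mem hG _, ?_, fun t => ?_⟩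
  · rw [IsSelfAdjoint, star_smul, hs, smul_neg, ← neg_smul]
    simp
  · rw [smul_smul, ← Complex.coe_smul]
    congr 1
    linear_combination (-(t : ℂ)) * Complex.I_mul_I

end WhiteNoise

end QSStone

/-! ### Stone's theorem -/

open QSStone QSStone.WhiteNoise QSStone.ProbSpace in
theorem mainTheorem3 {H : Type*} [NormedAddCommGroup H] [InnerProductSpace ℂ H]
    [CompleteSpace H] (W : QSStone.WhiteNoise H) :
    (∀ (u : ℝ → W.A) (b : ℝ → W.L2), W.IsUnitaryData u → W.IsAdditiveData b →
      (W.IsStochasticDerivative u b ∨ W.SolvesSDE b u) →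
      (W.WeaklyDifferentiableAtZero (fun t => W.ι (u t)) ∨ W.WeaklyDifferentiableAtZero b) →
      ∃ h : W.A, h.op ∈ W.base ∧ IsSelfAdjoint h ∧ ∀ t : ℝ, 0 ≤ t →
        u t = NormedSpace.exp ((Complex.I * (t : ℂ)) • h) ∧
        b t = W.ι ((Complex.I * (t : ℂ)) • h)) ∧
    (∀ u : ℝ → W.A, W.IsUnitaryData u →
      W.WeaklyDifferentiableAtZero (fun t => W.ι (u t)) →
      ∃ b : ℝ → W.L2, W.IsAdditiveData b ∧ W.IsStochasticDerivative u b ∧ W.SolvesSDE b u) ∧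
    (∀ b : ℝ → W.L2, W.IsAdditiveData b → W.WeaklyDifferentiableAtZero b →
      ∃ u : ℝ → W.A, W.IsUnitaryData u ∧ W.IsStochasticDerivative u b ∧ W.SolvesSDE b u) := by
  refine ⟨fun u b hu hb hrel hdiff => ?_, fun u hu hd => ?_, fun b hb hd => ?_⟩
  · obtain ⟨G, hG⟩ := hu.exists_generator
    have hdrift : drift b = W.ι G := hrel.elim hG.drift_eq_of_derivative
      (hG.drift_eq_of_solvesSDE hu.toIsUnitaryCocycle hb.toIsAdditiveCocycle)
    have hmart : b 1 = drift b := by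
      rcases hdiff with hd | hd
      · have hs := hG.star_eq_neg hu.toIsUnitaryCocycle hd
        -- the trace of a skew adjoint element is imaginary, so the martingale part vanishes
        have h1 := hb.norm_sq_sub_drift
        have h2 : (W.τ G).re = 0 := by
          have h3 := congrArg Complex.re (τ_star (P := W.toProbSpace) G)
          rw [hs, map_neg, Complex.neg_re, Complex.star_def, Complex.conj_re] at h3
          linarith
        rw [hdrift, ← τ_eq_inner, h2, mul_zero, ← hdrift] at h1
        exact sub_eq_zero.1 (norm_eq_zero.1 (pow_eq_zero_iff two_ne_zero |>.1 h1))
      · exact hb.eq_drift_of_differentiable hd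
    have hs : star G = -G := by
      apply ι_injective (P := W.toProbSpace)
      rw [← adj_ι, ← hdrift, hb.adj_drift hmart, hdrift, map_neg]
    obtain ⟨h, hB, hsa, hh⟩ := exists_isSelfAdjoint_smul hG.1 hs
    refine ⟨h, hB, hsa, fun t ht => ?_⟩
    rw [hh t, hG.eq_exp hu.toIsUnitaryCocycle hs ht, hb.eq_smul hmart ht, hdrift, ι_real_smul]
    exact ⟨rfl, rfl⟩
  · obtain ⟨G, hG⟩ := hu.exists_generator
    have hs := hG.star_eq_neg hu.toIsUnitaryCocycle hd
    have hue := fun t ht => hG.eq_exp hu.toIsUnitaryCocycle hs (t := t) ht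
    exact ⟨fun t => t • W.ι G, isAdditiveData_smul hG.1 hs,
      isStochasticDerivative_exp hG.1 hue fun _ _ => rfl,
      solvesSDE_exp hu.toIsUnitaryCocycle hs hue fun _ _ => rfl⟩
  · have hmart := hb.eq_drift_of_differentiable hd
    obtain ⟨G, hG, hs, hGk⟩ := hb.exists_drift_eq hmart
    have hbe : ∀ t, 0 ≤ t → b t = t • W.ι G := fun t ht => by rw [hGk]; exact hb.eq_smul hmart ht
    have hu := isUnitaryData_exp hG hs
    exact ⟨_, hu, isStochasticDerivative_exp hG (fun _ _ => rfl) hbe,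
      solvesSDE_exp hu.toIsUnitaryCocycle hs (fun _ _ => rfl) hbe⟩
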